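/- Let $T$ be a first-order theory (in a language of any cardinality), and let $\mathbb{O}$ be a monster model of $T$: for some uncountable cardinal $\kappa$, it is $\kappa$-saturated and strongly $\kappa$-homogeneous. Let $A \subseteq \mathbb{O}$ be a small set, i.e. $|A|<\kappa$. Variables and parameters $x, y, b, c,\dots$ denote finite tuples, and a global type is a complete type over $\mathbb{O}$. **The comb tree property.** The class of right-combs in $2^{<\omega}$ is the smallest class of sets that contains all sets of cardinality at most $1$ and contains $X \subseteq 2^{<\omega}$ whenever there is a $\sigma \in 2^{<\omega}$ such that every element of $X$ properly extends $\sigma$, exactly one element of $X$ extends $\sigma\frown 0$, and $\{\tau \in X : \tau \text{ extends } \sigma \frown 1\}$ is a right-comb. $T$ has CTP if for some $k<\omega$ there are a formula $\varphi(x,y)$ and a tree $(b_\sigma)_{\sigma \in 2^{<\omega}}$ of parameters in a model of $T$ such that for every path $\alpha \in 2^\omega$ the family $(\varphi(x,b_{\alpha\restriction n}))_{n<\omega}$ is $k$-inconsistent (any $k$ members with distinct indices are jointly inconsistent), while for every right-comb $X$ the set $\{\varphi(x,b_\sigma):\sigma\in X\}$ is consistent. $T$ is NCTP if it does not have CTP.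 **Invariance.** A global type is $A$-invariant if it is fixed by every automorphism of $\mathbb{O}$ fixing $A$ pointwise. $A$ is an invariance base if every type over $A$ extends to a global $A$-invariant type. A global type $p(x)$ is extendibly $A$-invariant if for every $q(x,y) \in S(A)$ extending $p\restriction A$, the set $p(x)\cup q(x,y)$ extends to a global $A$-invariant type. **Kim-dividing and Kim-forking.** A Morley sequence over $A$ generated by a global type $p(y)$ is a sequence $(e_i)_{i<\omega}$ in $\mathbb{O}$ such that $e_i$ realizes the restriction of $p$ to $A\cup\{e_j : j<i\}$ for every $i$. A formula $\varphi(x,b)$ Kim-divides over $A$ with regards to extendibly invariant types if there are an extendibly $A$-invariant global type $p(y)$ extending $\operatorname{tp}(b/A)$ and a Morley sequence $(e_i)_{i<\omega}$ over $A$ generated by $p$ such that $\{\varphi(x,e_i): i<\omega\}$ is inconsistent. It Kim-forks over $A$ with regards to extendibly invariant types if there are $n<\omega$ and formulas $\psi_0(x,c_0),\dots,\psi_{n-1}(x,c_{n-1})$ with $\varphi(x,b)\vdash\bigvee_{i<n}\psi_i(x,c_i)$ such that each $\psi_i(x,c_i)$ Kim-divides over $A$ with regards to extendibly invariant types. **Statement.**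 Suppose that $T$ is NCTP and that $A$ is an invariance base. Then for every formula $\varphi(x,y)$ and every tuple $b$ in $\mathbb{O}$, the formula $\varphi(x,b)$ Kim-forks over $A$ with regards to extendibly invariant types if and only if it Kim-divides over $A$ with regards to extendibly invariant types. -/

import Mathlib

open FirstOrder FirstOrder.Language Cardinal

universe u v w

namespace KimForking

variable {L : FirstOrder.Language.{u, v}}

section Types

/-- `Contains p φ` says that the formula `φ(x)`, with parameters from `C` and variables `x`
indexed by `α`, belongs to the complete type `p(x)`. A formula with parameters is an `L`-formula
whose free variables from `C` stand for the parameters. -/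
def Contains {C : Type*} {Θ : L[[C]].Theory} {α : Type*} (p : Θ.CompleteType α)
    (φ : L.Formula (C ⊕ α)) : Prop :=
  Formula.equivSentence (BoundedFormula.constantsVarsEquiv.symm φ : L[[C]].Formula α) ∈ p

variable (L) {M : Type w} [L.Structure M]

/-- `S_α(A)`: the complete types over the set of parameters `A ⊆ M` in variables indexed by `α`. -/
abbrev TypeOver (A : Set M) (α : Type) := (L[[A]].completeTheory M).CompleteType α

variable (M) in
/-- `S_α(M)`: the complete types over the whole structure; if `M` is the monster model these are
the global types. -/
abbrev GlobalType (α : Type) := (L.elementaryDiagram M).CompleteType α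

/-- `tp(b/A)`. -/
def tp [Nonempty M] {α : Type} (b : α → M) (A : Set M) : TypeOver L A α :=
  (L[[A]].completeTheory M).typeOf b

variable {L}

/-- The restriction of the global type `p` to the set of parameters `A` is `q`. -/
def Extends {α : Type} {A : Set M} (p : GlobalType L M α) (q : TypeOver L A α) : Prop :=
  ∀ φ : L.Formula (A ⊕ α), Contains q φ → Contains p (φ.relabel (Sum.map (↑) id))

/-- `v ⊨ p ↾ B`. -/
def RealizesOver {α : Type} (B : Set M) (p : GlobalType L M α) (v : α → M) : Prop :=
  ∀ φ : L.Formula (B ⊕ α), Contains p (φ.relabel (Sum.map (↑) id)) →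
    φ.Realize (Sum.elim (↑) v)

/-- The global type `p` is `Aut(M/A)`-invariant. -/
def IsInvariant {α : Type} (A : Set M) (p : GlobalType L M α) : Prop :=
  ∀ σ : M ≃[L] M, (∀ a ∈ A, σ a = a) →
    ∀ φ : L.Formula (M ⊕ α), Contains p φ ↔ Contains p (φ.relabel (Sum.map σ id))

/-- The global type `p(x)` is extendibly `A`-invariant: for every `q(x,y) ∈ S(A)` extending
`p ↾ A`, the set `p(x) ∪ q(x,y)` extends to a global `A`-invariant type `r(x,y)`. -/
def IsExtendiblyInvariant {α : Type} (A : Set M) (p : GlobalType L M α) : Prop :=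
  ∀ (n : ℕ) (q : TypeOver L A (α ⊕ Fin n)),
    (∀ φ : L.Formula (A ⊕ α), Contains p (φ.relabel (Sum.map (↑) id)) →
      Contains q (φ.relabel (Sum.map id Sum.inl))) →
    ∃ r : GlobalType L M (α ⊕ Fin n), IsInvariant A r ∧
      (∀ φ : L.Formula (M ⊕ α), Contains p φ → Contains r (φ.relabel (Sum.map id Sum.inl))) ∧
      Extends r q

variable (L) in
/-- `A` is an invariance base: every type over `A` extends to a global `A`-invariant type. -/
def IsInvarianceBase (A : Set M) : Prop :=
  ∀ (n : ℕ) (q : TypeOver L A (Fin n)),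
    ∃ p : GlobalType L M (Fin n), IsInvariant A p ∧ Extends p q

variable (L M) in
/-- `M` is a monster model of degree of saturation `κ`: it is `κ`-saturated and strongly
`κ`-homogeneous, with `κ` uncountable. Sets of parameters of size less than `κ` are small. -/
structure IsMonster [Nonempty M] (κ : Cardinal.{w}) : Prop where
  uncountable : ℵ₀ < κ
  saturated : ∀ A : Set M, #A < κ → ∀ q : TypeOver L A (Fin 1), ∃ a : Fin 1 → M, tp L a A = q
  homogeneous : ∀ (A : Set M) (f : A → M), #A < κ →
    (∀ φ : L.Formula A, φ.Realize ((↑) : A → M) ↔ φ.Realize f) →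
    ∃ σ : M ≃[L] M, ∀ a : A, σ a = f a

end Types

section Consistency

variable {M : Type w} [L.Structure M] {α β : Type} {ι : Type}

/-- The family of formulas `{φ(x, b_i) : i ∈ S}` is consistent, i.e. finitely satisfiable. -/
def IsConsistent (φ : L.Formula (α ⊕ β)) (b : ι → β → M) (S : Set ι) : Prop :=
  ∀ s : Finset ι, (s : Set ι) ⊆ S → ∃ a : α → M, ∀ i ∈ s, φ.Realize (Sum.elim a (b i))

/-- The family of formulas `(φ(x, b_i))_i` is `k`-inconsistent: any `k` members with distinct
indices are inconsistent. -/
def IsKInconsistent (k : ℕ) (φ : L.Formula (α ⊕ β)) (b : ι → β → M) : Prop :=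
  ∀ s : Finset ι, s.card = k → ¬ IsConsistent φ b (s : Set ι)

end Consistency

section KimDividing

variable {M : Type w} [L.Structure M] {α β : Type}

/-- `(e_i)_{i < ω}` is a Morley sequence over `A` generated by `p`: `e_i ⊨ p ↾ A e_{<i}`. -/
def IsMorleySequence (A : Set M) (p : GlobalType L M β) (e : ℕ → β → M) : Prop :=
  ∀ i, RealizesOver (A ∪ ⋃ j < i, Set.range (e j)) p (e i)

/-- `φ(x,y)` `p`-Kim-divides over `A`: `{φ(x, e_i) : i < ω}` is inconsistent for a Morley sequence
`(e_i)_{i < ω}` over `A` generated by `p(y)`. -/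
def KimDividesAlong (A : Set M) (p : GlobalType L M β) (φ : L.Formula (α ⊕ β)) : Prop :=
  ∃ e : ℕ → β → M, IsMorleySequence A p e ∧ ¬ IsConsistent φ e Set.univ

/-- `φ(x,b)` Kim-divides over `A` with regards to extendibly invariant types. -/
def KimDivides [Nonempty M] (A : Set M) (φ : L.Formula (α ⊕ β)) (b : β → M) : Prop :=
  ∃ p : GlobalType L M β, IsExtendiblyInvariant A p ∧ Extends p (tp L b A) ∧ KimDividesAlong A p φ

/-- `φ(x,b)` Kim-forks over `A` with regards to extendibly invariant types: it implies a finite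
disjunction of formulas, each of which Kim-divides over `A` with regards to such types. -/
def KimForks [Nonempty M] (A : Set M) (φ : L.Formula (α ⊕ β)) (b : β → M) : Prop :=
  ∃ (n : ℕ) (m : Fin n → ℕ) (ψ : ∀ i, L.Formula (α ⊕ Fin (m i))) (c : ∀ i, Fin (m i) → M),
    (∀ a : α → M, φ.Realize (Sum.elim a b) → ∃ i, (ψ i).Realize (Sum.elim a (c i))) ∧
    ∀ i, KimDivides A (ψ i) (c i)

end KimDividing

section CTP

/-- The right-combs in the tree `2^{<ω}` of finite binary sequences. -/
inductive IsRightComb : Set (List Bool) → Prop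
  | subsingleton (X : Set (List Bool)) : X.Subsingleton → IsRightComb X
  | step (X : Set (List Bool)) (σ : List Bool) :
      (∀ τ ∈ X, σ <+: τ ∧ τ ≠ σ) →
      (∃ τ, X ∩ {ρ | σ ++ [false] <+: ρ} = {τ}) →
      IsRightComb (X ∩ {ρ | σ ++ [true] <+: ρ}) →
      IsRightComb X

/-- The theory `T` has `k`-CTP. -/
def HasKCTP (k : ℕ) (T : L.Theory) : Prop :=
  ∃ (M : Theory.ModelType.{u, v, max u v} T) (l m : ℕ) (φ : L.Formula (Fin l ⊕ Fin m)) (b : List Bool → Fin m → M),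
    (∀ α : ℕ → Bool, IsKInconsistent k φ fun n => b ((List.range n).map α)) ∧
    ∀ X : Set (List Bool), IsRightComb X → IsConsistent φ b X

/-- The theory `T` has the comb tree property. -/
def HasCTP (T : L.Theory) : Prop :=
  ∃ k : ℕ, HasKCTP k T

end CTP

end KimForking

/-!
A global type is given by an ultrafilter on tuples of the monster `M`. With `A` an invariance base,
the extendibly `A`-invariant types extending `tp(c/A)` are exactly the types that the `A`-invariant
extensions `R` of `tp(M/A)` assign to the subtuple `c` of `M`.

Some such type `q` of `c` is universal: whenever conjugates of `c` over `A` are obtained from one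
another by taking independent copies, one `A`-invariant extension of `tp(M/A)` gives all of them the
type `q`. Otherwise every `R` has a neighbourhood on which universality fails for a fixed finite
list of conjugates. By compactness finitely many of these neighbourhoods cover everything, and
substituting the corresponding lists into one another contradicts the existence of any `R`.

If `ψ(x, c)` Kim-divides along a type `p` of `c`, it Kim-divides along `q`. Otherwise, build trees
of every finite height: given a tree, realize its whole type, as assigned by an extension giving all
its nodes the type `q`, over the tree itself, to get a second copy, and put on top a realization of
`p` over both copies. Paths are Morley sequences of `p` and right-combs are Morley sequences of `q`,
so `ψ` has the comb tree property.

Finally, let `φ(x, b)` Kim-fork, and let `c` collect the parameters of a witnessing disjunction. All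
of its disjuncts Kim-divide along `q`, so by the pigeonhole principle `φ(x, b)` Kim-divides along
the restriction of `q` to `b`.
-/

open scoped Pointwise

namespace KimForking

variable {L : FirstOrder.Language.{u, v}}

section Automorphisms

variable {M : Type w} [L.Structure M]

variable (L M) in
/-- The automorphism group of the structure `M`, as a group of permutations: `M ≃[L] M` itself
carries no group structure, and this way the group acts on points, tuples and sets. -/
def automorphismGroup : Subgroup (Equiv.Perm M) where
  carrier := Set.range fun σ : M ≃[L] M => σ.toEquiv
  one_mem' := ⟨FirstOrder.Language.Equiv.refl L M, rfl⟩
  mul_mem' := by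
    rintro _ _ ⟨σ, rfl⟩ ⟨τ, rfl⟩
    exact ⟨σ.comp τ, rfl⟩
  inv_mem' := by
    rintro _ ⟨σ, rfl⟩
    exact ⟨σ.symm, rfl⟩

variable (L) in
/-- The group `Aut(M/B)` of automorphisms of `M` that fix `B` pointwise. -/
def autFixing (B : Set M) : Subgroup (Equiv.Perm M) :=
  automorphismGroup L M ⊓ fixingSubgroup (Equiv.Perm M) B

variable {A B : Set M} {α β : Type*}

theorem exists_equiv_apply_eq_smul (g : autFixing L B) : ∃ σ : M ≃[L] M, ∀ x, σ x = g • x := by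
  obtain ⟨σ, hσ⟩ := g.2.1
  exact ⟨σ, DFunLike.congr_fun hσ⟩

theorem exists_smul_eq_apply (σ : M ≃[L] M) (hσ : ∀ b ∈ B, σ b = b) :
    ∃ g : autFixing L B, ∀ x, g • x = σ x :=
  ⟨⟨σ.toEquiv, ⟨σ, rfl⟩, (mem_fixingSubgroup_iff _).2 hσ⟩, fun _ => rfl⟩

theorem smul_eq_of_mem (g : autFixing L B) {b : M} (hb : b ∈ B) : g • b = b :=
  (mem_fixingSubgroup_iff _).1 g.2.2 b hb

theorem smul_set_eq (g : autFixing L B) : g • B = B :=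
  (Set.image_congr fun _ hb => smul_eq_of_mem g hb).trans (Set.image_id B)

theorem autFixing_anti (h : A ⊆ B) : autFixing L B ≤ autFixing L A :=
  inf_le_inf_left _ (fixingSubgroup_antitone _ _ h)

theorem smul_sumElim (g : autFixing L B) (x : α → M) (y : β → M) :
    g • Sum.elim x y = Sum.elim (g • x) (g • y) := by
  ext (i | j) <;> rfl

theorem realize_smul (g : autFixing L B) (φ : L.Formula α) (v : α → M) :
    φ.Realize (g • v) ↔ φ.Realize v := by
  obtain ⟨σ, hσ⟩ := exists_equiv_apply_eq_smul g
  have hv : g • v = σ ∘ v := funext fun i => (hσ (v i)).symm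
  rw [hv, StrongHomClass.realize_formula]

end Automorphisms

section Definability

variable {M : Type w} [L.Structure M] {A B : Set M} {α β : Type*}

theorem definable_setOf_realize (φ : L.Formula (B ⊕ α)) :
    B.Definable L {v : α → M | φ.Realize (Sum.elim (↑) v)} :=
  Set.definable_iff_exists_formula_sum.2 ⟨φ, rfl⟩

theorem definable_univ_iff {s : Set (α → M)} :
    (Set.univ : Set M).Definable L s ↔
      ∃ φ : L.Formula (M ⊕ α), s = {v | φ.Realize (Sum.elim id v)} := by
  rw [Set.definable_iff_exists_formula_sum]
  constructor
  · rintro ⟨φ, rfl⟩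
    refine ⟨φ.relabel (Sum.map (↑) id), ?_⟩
    simp only [Formula.realize_relabel, Sum.elim_comp_map, Function.id_comp, Function.comp_id]
  · rintro ⟨φ, rfl⟩
    refine ⟨φ.relabel (Sum.map (fun a => ⟨a, trivial⟩) id), ?_⟩
    simp only [Formula.realize_relabel, Sum.elim_comp_map, Function.comp_id]
    rfl

theorem definable_setOf_sumElim {s : Set (α ⊕ β → M)} (hs : B.Definable L s) (v : α → M) :
    (B ∪ Set.range v).Definable L {a : β → M | Sum.elim v a ∈ s} := by
  obtain ⟨φ, rfl⟩ := Set.definable_iff_exists_formula_sum.1 hs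
  refine Set.definable_iff_exists_formula_sum.2 ⟨φ.relabel (Sum.elim
    (fun b : B => Sum.inl ⟨b, Or.inl b.2⟩)
    (Sum.elim (fun i => Sum.inl ⟨v i, Or.inr ⟨i, rfl⟩⟩) Sum.inr)), ?_⟩
  ext a
  simp only [Set.mem_ofPred_eq, Formula.realize_relabel]
  refine iff_of_eq (congrArg _ ?_)
  ext (b | i | j) <;> rfl

theorem smul_mem_iff_of_definable (g : autFixing L B) {s : Set (α → M)} (hs : B.Definable L s)
    {v : α → M} : g • v ∈ s ↔ v ∈ s := by
  obtain ⟨φ, rfl⟩ := Set.definable_iff_exists_formula_sum.1 hs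
  have hB : g • ((↑) : B → M) = (↑) := funext fun b => smul_eq_of_mem g b.2
  simp only [Set.mem_ofPred_eq]
  rw [← realize_smul g φ (Sum.elim _ v), smul_sumElim, hB]

theorem definable_smul (g : autFixing L A) {s : Set (α → M)} (hs : B.Definable L s) :
    (g • B).Definable L (g • s) := by
  obtain ⟨φ, rfl⟩ := Set.definable_iff_exists_formula_sum.1 hs
  refine Set.definable_iff_exists_formula_sum.2
    ⟨φ.relabel (Sum.map (fun b : B => ⟨g • (b : M), Set.smul_mem_smul_set b.2⟩) id), ?_⟩
  ext v
  rw [Set.mem_smul_set_iff_inv_smul_mem]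
  simp only [Set.mem_ofPred_eq, Formula.realize_relabel, Sum.elim_comp_map]
  rw [← realize_smul g φ, smul_sumElim, smul_inv_smul]
  rfl

end Definability

section Types

theorem exists_ultrafilter_of_inter_mem {X : Type*} {S : Set (Set X)} (hne : S.Nonempty)
    (hinter : ∀ s ∈ S, ∀ t ∈ S, s ∩ t ∈ S) (h : ∀ s ∈ S, s.Nonempty) :
    ∃ U : Ultrafilter X, ∀ s ∈ S, s ∈ U := by
  let B : FilterBasis X := ⟨S, hne, fun hs ht => ⟨_, hinter _ hs _ ht, subset_rfl⟩⟩
  have : B.filter.NeBot := B.hasBasis.neBot_iff.2 fun hs => h _ hs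
  exact ⟨Ultrafilter.of B.filter, fun s hs => Ultrafilter.of_le _ (B.mem_filter_of_mem hs)⟩

theorem exists_completeType_of_ultrafilter {L' : FirstOrder.Language} {T : L'.Theory}
    {M : Type*} [L'.Structure M] [Nonempty M] [M ⊨ T] {α : Type*} (U : Ultrafilter (α → M)) :
    ∃ p : T.CompleteType α, ∀ φ : L'.Formula α,
      Formula.equivSentence φ ∈ p ↔ {v | φ.Realize v} ∈ U := by
  let N := (U : Filter (α → M)).Product fun _ => M
  have hN : N ⊨ T := ⟨fun φ hφ => Ultraproduct.sentence_realize φ |>.2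
    (Filter.Eventually.of_forall fun _ => Theory.realize_sentence_of_mem T hφ)⟩
  let x : α → (α → M) → M := fun i v => v i
  let y : α → N := fun i =>
    (Quotient.mk _ (x i) : Quotient (Filter.productSetoid (U : Filter (α → M)) _))
  exact ⟨T.typeOf y, fun φ =>
    Theory.CompleteType.formula_mem_typeOf.trans (Ultraproduct.realize_formula_cast _ x)⟩

theorem sentence_realize_iExs_iff {L' : FirstOrder.Language} {M : Type*} [L'.Structure M]
    {α : Type*} [Finite α] (φ : L'.Formula α) :
    M ⊨ (Formula.iExs α (φ.relabel (Sum.inr : α → Empty ⊕ α)) : L'.Sentence) ↔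
      ∃ v : α → M, φ.Realize v := by
  simp only [Sentence.Realize, Formula.realize_iExs, Formula.realize_relabel, Sum.elim_comp_inr]

theorem exists_realize_of_mem_completeType {L' : FirstOrder.Language} {M : Type*} [L'.Structure M]
    {α : Type*} [Finite α] (p : (L'.completeTheory M).CompleteType α) {φ : L'.Formula α}
    (hφ : Formula.equivSentence φ ∈ p) : ∃ v : α → M, φ.Realize v := by
  obtain ⟨N, v, rfl⟩ := Theory.exists_modelType_is_realized_in _ p
  rw [Theory.CompleteType.formula_mem_typeOf] at hφ
  exact (sentence_realize_iExs_iff φ).1 <|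
    (realize_iff_of_model_completeTheory M N _).1 ((sentence_realize_iExs_iff φ).2 ⟨v, hφ⟩)

theorem exists_ultrafilter_of_completeType {L' : FirstOrder.Language} {M : Type*}
    [L'.Structure M] {α : Type*} [Finite α] (p : (L'.completeTheory M).CompleteType α) :
    ∃ U : Ultrafilter (α → M), ∀ φ : L'.Formula α,
      Formula.equivSentence φ ∈ p ↔ {v | φ.Realize v} ∈ U := by
  have mem_inf (φ ψ : L'.Formula α) (hφ : Formula.equivSentence φ ∈ p)
      (hψ : Formula.equivSentence ψ ∈ p) : Formula.equivSentence (φ ⊓ ψ) ∈ p := by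
    obtain ⟨N, v, rfl⟩ := Theory.exists_modelType_is_realized_in _ p
    rw [Theory.CompleteType.formula_mem_typeOf] at hφ hψ ⊢
    exact Formula.realize_inf.2 ⟨hφ, hψ⟩
  have mem_not (φ : L'.Formula α) (hφ : Formula.equivSentence φ ∉ p) :
      Formula.equivSentence φ.not ∈ p := p.not_mem_iff _ |>.2 hφ
  have top_mem : Formula.equivSentence (⊤ : L'.Formula α) ∈ p := by
    obtain ⟨N, v, rfl⟩ := Theory.exists_modelType_is_realized_in _ p
    exact Theory.CompleteType.formula_mem_typeOf.2 (Formula.realize_top.2 trivial)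
  obtain ⟨U, hU⟩ := exists_ultrafilter_of_inter_mem
    (S := (fun φ : L'.Formula α => {v : α → M | φ.Realize v}) ''
      {φ | Formula.equivSentence φ ∈ p}) ⟨_, ⊤, top_mem, rfl⟩
    (by
      rintro _ ⟨φ, hφ, rfl⟩ _ ⟨ψ, hψ, rfl⟩
      exact ⟨φ ⊓ ψ, mem_inf φ ψ hφ hψ, Set.ext fun v => Formula.realize_inf⟩)
    (by
      rintro _ ⟨φ, hφ, rfl⟩
      exact exists_realize_of_mem_completeType p hφ)
  refine ⟨U, fun φ => ⟨fun hφ => hU _ ⟨φ, hφ, rfl⟩, fun hφ => ?_⟩⟩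
  by_contra hn
  exact Ultrafilter.compl_mem_iff_notMem.1 (hU _ ⟨φ.not, mem_not φ hn, rfl⟩) hφ

theorem realize_constantsVarsEquiv_symm {C α N : Type*} [L.Structure N] [L[[C]].Structure N]
    [(L.lhomWithConstants C).IsExpansionOn N] (φ : L.Formula (C ⊕ α)) (v : α → N) :
    Formula.Realize (BoundedFormula.constantsVarsEquiv.symm φ : L[[C]].Formula α) v ↔
      φ.Realize (Sum.elim (fun c => (L.con c : N)) v) := by
  have := BoundedFormula.realize_constantsVarsEquiv (M := N) (v := v) (xs := default)
    (φ := (BoundedFormula.constantsVarsEquiv.symm φ : L[[C]].Formula α))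
  rw [Equiv.apply_symm_apply] at this
  exact this.symm

section Contains

variable {M : Type w} [L.Structure M] {C : Type*} [L[[C]].Structure M]
  [(L.lhomWithConstants C).IsExpansionOn M] {α : Type*}

theorem exists_contains_iff_mem_ultrafilter [Nonempty M] (U : Ultrafilter (α → M)) :
    ∃ p : (L[[C]].completeTheory M).CompleteType α, ∀ φ : L.Formula (C ⊕ α),
      Contains p φ ↔ {v | φ.Realize (Sum.elim (fun c => (L.con c : M)) v)} ∈ U := by
  obtain ⟨p, hp⟩ := exists_completeType_of_ultrafilter (T := L[[C]].completeTheory M) U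
  refine ⟨p, fun φ => ?_⟩
  simp only [Contains, hp, realize_constantsVarsEquiv_symm]

theorem exists_mem_ultrafilter_iff_contains [Finite α]
    (p : (L[[C]].completeTheory M).CompleteType α) :
    ∃ U : Ultrafilter (α → M), ∀ φ : L.Formula (C ⊕ α),
      Contains p φ ↔ {v | φ.Realize (Sum.elim (fun c => (L.con c : M)) v)} ∈ U := by
  obtain ⟨U, hU⟩ := exists_ultrafilter_of_completeType p
  refine ⟨U, fun φ => ?_⟩
  simp only [Contains, hU, realize_constantsVarsEquiv_symm]

end Contains

theorem contains_tp {M : Type w} [L.Structure M] [Nonempty M] {α : Type} {B : Set M} (a : α → M)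
    (φ : L.Formula (B ⊕ α)) : Contains (tp L a B) φ ↔ φ.Realize (Sum.elim (↑) a) :=
  Theory.CompleteType.formula_mem_typeOf.trans (realize_constantsVarsEquiv_symm φ a)

end Types

section Realizes

variable {M : Type w} [L.Structure M] {α β γ : Type*}

variable (L) in
/-- The tuple `v` realizes the restriction to `B` of the global type to which the ultrafilter `U`
converges. Ultrafilters on tuples stand for global types throughout: one on `α → M` converges to
the type given by the definable sets that belong to it. -/
def Realizes (U : Ultrafilter (α → M)) (B : Set M) (v : α → M) : Prop :=
  ∀ s, B.Definable L s → (s ∈ U ↔ v ∈ s)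

/-- The type of the tuple `x ∘ j` for `x` a realization of the type `U`. -/
def reindex (U : Ultrafilter (α → M)) (j : β → α) : Ultrafilter (β → M) :=
  U.map (· ∘ j)

variable {U : Ultrafilter (α → M)} {B C : Set M} {v v' : α → M}

theorem realizes_of_forall_mem (h : ∀ s, B.Definable L s → s ∈ U → v ∈ s) : Realizes L U B v :=
  fun s hs => ⟨h s hs, fun hv => by
    by_contra hn
    exact h sᶜ hs.compl (Ultrafilter.compl_mem_iff_notMem.2 hn) hv⟩

theorem Realizes.mono (h : Realizes L U C v) (hBC : B ⊆ C) : Realizes L U B v :=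
  fun s hs => h s (hs.mono hBC)

theorem Realizes.reindex (h : Realizes L U B v) (j : β → α) :
    Realizes L (reindex U j) B (v ∘ j) :=
  fun _ hs => h _ (hs.preimage_comp j)

theorem Realizes.realize_iff (h : Realizes L U B v) (h' : Realizes L U B v')
    (φ : L.Formula (B ⊕ α)) :
    φ.Realize (Sum.elim (↑) v) ↔ φ.Realize (Sum.elim (↑) v') :=
  (h _ (definable_setOf_realize φ)).symm.trans (h' _ (definable_setOf_realize φ))

theorem Realizes.sumElim_eq_iff (h : Realizes L U B v) (h' : Realizes L U B v') (x y : B ⊕ α) :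
    Sum.elim (↑) v x = (Sum.elim (↑) v y : M) ↔ Sum.elim (↑) v' x = (Sum.elim (↑) v' y : M) := by
  simpa only [Formula.realize_equal, Term.realize_var] using
    h.realize_iff h' ((Term.var x).equal (Term.var y))

theorem mem_reindex {j : β → α} {s : Set (β → M)} : s ∈ reindex U j ↔ (· ∘ j) ⁻¹' s ∈ U :=
  Iff.rfl

theorem reindex_reindex (U : Ultrafilter (α → M)) (j : β → α) (i : γ → β) :
    reindex (reindex U j) i = reindex U (j ∘ i) :=
  Ultrafilter.map_map ..

theorem exists_ultrafilter_sumElim_mem [Finite β] (U : Ultrafilter (α ⊕ β → M)) {v : α → M}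
    (hv : Realizes L (reindex U Sum.inl) B v) :
    ∃ W : Ultrafilter (β → M), ∀ s, B.Definable L s → s ∈ U → {a | Sum.elim v a ∈ s} ∈ W := by
  obtain ⟨W, hW⟩ := exists_ultrafilter_of_inter_mem
    (S := (fun s => {a : β → M | Sum.elim v a ∈ s}) '' {s | B.Definable L s ∧ s ∈ U})
    ⟨_, _, ⟨Set.definable_univ, Filter.univ_mem⟩, rfl⟩
    (by
      rintro _ ⟨s, ⟨hs, hsU⟩, rfl⟩ _ ⟨t, ⟨ht, htU⟩, rfl⟩
      exact ⟨s ∩ t, ⟨hs.inter ht, Filter.inter_mem hsU htU⟩, rfl⟩)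
    (by
      rintro _ ⟨s, ⟨hs, hsU⟩, rfl⟩
      refine (hv _ hs.exists_of_finite).1 (mem_reindex.2 ?_)
      filter_upwards [hsU] with f hf
      exact ⟨f ∘ Sum.inr, by rwa [Sum.elim_comp_inl_inr]⟩)
  exact ⟨W, fun s hs hsU => hW _ ⟨s, ⟨hs, hsU⟩, rfl⟩⟩

end Realizes

section Monster

variable {M : Type w} [L.Structure M] [Nonempty M] {κ : Cardinal.{w}} {B F : Set M}

theorem IsMonster.mk_union_lt (hM : IsMonster L M κ) (hB : #B < κ) (hF : F.Finite) :
    #(B ∪ F : Set M) < κ :=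
  (mk_union_le B F).trans_lt
    (add_lt_of_lt hM.uncountable.le hB (hF.lt_aleph0.trans hM.uncountable))

theorem IsMonster.exists_smul_eq (hM : IsMonster L M κ) (hB : #B < κ) {ι : Type*} [Finite ι]
    {U : Ultrafilter (ι → M)} {c c' : ι → M} (h : Realizes L U B c) (h' : Realizes L U B c') :
    ∃ g : autFixing L B, g • c = c' := by
  have exists_index : ∀ x : ↥(B ∪ Set.range c), ∃ y : B ⊕ ι, Sum.elim (↑) c y = (x : M) := by
    rintro ⟨_, hx | ⟨i, rfl⟩⟩
    exacts [⟨Sum.inl ⟨_, hx⟩, rfl⟩, ⟨Sum.inr i, rfl⟩]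
  choose r hr using exists_index
  obtain ⟨σ, hσ⟩ := hM.homogeneous (B ∪ Set.range c) (fun x => Sum.elim (↑) c' (r x))
    (hM.mk_union_lt hB (Set.finite_range c)) fun φ => by
      have := h.realize_iff h' (φ.relabel r)
      rw [Formula.realize_relabel, Formula.realize_relabel] at this
      exact (iff_of_eq (congrArg φ.Realize (funext hr))).symm.trans this
  have σ_apply (y : B ⊕ ι) : σ (Sum.elim (↑) c y) = Sum.elim (↑) c' y := by
    have hy : Sum.elim (↑) c y ∈ B ∪ Set.range c := by
      rcases y with b | i
      exacts [Or.inl b.2, Or.inr ⟨i, rfl⟩]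
    exact (hσ ⟨_, hy⟩).trans ((h.sumElim_eq_iff h' _ y).1 (hr ⟨_, hy⟩))
  obtain ⟨g, hg⟩ := exists_smul_eq_apply σ fun b hb => σ_apply (Sum.inl ⟨b, hb⟩)
  exact ⟨g, funext fun i => (hg _).trans (σ_apply (Sum.inr i))⟩

theorem IsMonster.exists_realizes_fin_one (hM : IsMonster L M κ) (hB : #B < κ)
    (U : Ultrafilter (Fin 1 → M)) : ∃ v, Realizes L U B v := by
  obtain ⟨q, hq⟩ := exists_contains_iff_mem_ultrafilter (L := L) (C := B) U
  obtain ⟨a, rfl⟩ := hM.saturated B hB q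
  refine ⟨a, fun s hs => ?_⟩
  obtain ⟨φ, rfl⟩ := Set.definable_iff_exists_formula_sum.1 hs
  exact (hq φ).symm.trans (contains_tp a φ)

theorem IsMonster.exists_realizes (hM : IsMonster L M κ) {ι : Type*} [Finite ι] (hB : #B < κ)
    (U : Ultrafilter (ι → M)) : ∃ v, Realizes L U B v := by
  revert U
  have of_equiv {α β : Type _} (e : α ≃ β)
      (h : ∀ U : Ultrafilter (α → M), ∃ v, Realizes L U B v) (U : Ultrafilter (β → M)) :
      ∃ v, Realizes L U B v := by
    obtain ⟨v, hv⟩ := h (reindex U e)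
    refine ⟨v ∘ e.symm, ?_⟩
    have := hv.reindex e.symm
    rwa [reindex_reindex, e.self_comp_symm] at this
  induction ι using Finite.induction_empty_option with
  | of_equiv e h => exact of_equiv e h
  | h_empty =>
    refine fun U => ⟨PEmpty.elim, realizes_of_forall_mem fun s _ hs => ?_⟩
    obtain ⟨x, hx⟩ := U.nonempty_of_mem hs
    rwa [Subsingleton.elim PEmpty.elim x]
  | h_option ih =>
    refine of_equiv ((Equiv.optionEquivSumPUnit.{0} _).trans
      (Equiv.sumCongr (Equiv.refl _) (Equiv.ofUnique PUnit (Fin 1)))).symm fun U => ?_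
    obtain ⟨v, hv⟩ := ih (reindex U Sum.inl)
    obtain ⟨W, hW⟩ := exists_ultrafilter_sumElim_mem U hv
    obtain ⟨a, ha⟩ := hM.exists_realizes_fin_one (hM.mk_union_lt hB (Set.finite_range v)) W
    exact ⟨Sum.elim v a, realizes_of_forall_mem fun s hs hsU =>
      (ha _ (definable_setOf_sumElim hs v)).1 (hW s hs hsU)⟩

end Monster

section Represents

variable {M : Type w} [L.Structure M] {α : Type*}

variable (L) in
/-- The global type to which the ultrafilter `U` converges is `Aut(M/A)`-invariant. -/
def IsAutInvariant (A : Set M) (U : Ultrafilter (α → M)) : Prop :=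
  ∀ (g : autFixing L A) (s : Set (α → M)), (Set.univ : Set M).Definable L s → (g • s ∈ U ↔ s ∈ U)

theorem setOf_realize_smul {A : Set M} (g : autFixing L A) (φ : L.Formula (M ⊕ α)) :
    g • {v | φ.Realize (Sum.elim id v)} =
      {v | (φ.relabel (Sum.map (g • ·) id)).Realize (Sum.elim id v)} := by
  ext v
  rw [Set.mem_smul_set_iff_inv_smul_mem]
  simp only [Set.mem_ofPred_eq, Formula.realize_relabel, Sum.elim_comp_map]
  rw [← realize_smul g φ, smul_sumElim, smul_inv_smul]
  rfl

section

variable {α : Type} {U : Ultrafilter (α → M)} {p : GlobalType L M α} {A : Set M}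

/-- The ultrafilter `U` on tuples converges to the global type `p`. -/
def Represents (U : Ultrafilter (α → M)) (p : GlobalType L M α) : Prop :=
  ∀ φ : L.Formula (M ⊕ α), Contains p φ ↔ {v | φ.Realize (Sum.elim id v)} ∈ U

theorem exists_represents [Finite α] (p : GlobalType L M α) : ∃ U, Represents U p :=
  exists_mem_ultrafilter_iff_contains (C := M) p

theorem exists_represents_of_ultrafilter [Nonempty M] (U : Ultrafilter (α → M)) :
    ∃ p : GlobalType L M α, Represents U p :=
  exists_contains_iff_mem_ultrafilter (C := M) U

theorem represents_of_forall_contains [Finite α]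
    (h : ∀ φ : L.Formula (M ⊕ α), Contains p φ → {v | φ.Realize (Sum.elim id v)} ∈ U) :
    Represents U p := by
  refine fun φ => ⟨h φ, fun hφ => ?_⟩
  by_contra hn
  obtain ⟨V, hV⟩ := exists_represents p
  have hnot : Contains p φ.not :=
    (hV _).2 (Ultrafilter.compl_mem_iff_notMem.2 fun h' => hn ((hV φ).2 h'))
  exact Ultrafilter.compl_mem_iff_notMem.1 (h _ hnot) hφ

namespace Represents

theorem contains_relabel_coe_iff (h : Represents U p) (φ : L.Formula (A ⊕ α)) :
    Contains p (φ.relabel (Sum.map (↑) id)) ↔ {v | φ.Realize (Sum.elim (↑) v)} ∈ U := by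
  rw [h]
  simp only [Formula.realize_relabel, Sum.elim_comp_map]
  rfl

theorem isInvariant_iff (h : Represents U p) : IsInvariant A p ↔ IsAutInvariant L A U := by
  constructor
  · intro hp g s hs
    obtain ⟨φ, rfl⟩ := definable_univ_iff.1 hs
    obtain ⟨σ, hσ⟩ := exists_equiv_apply_eq_smul g
    have := hp σ (fun a ha => (hσ a).trans (smul_eq_of_mem g ha)) φ
    rw [h, h, funext hσ, ← setOf_realize_smul] at this
    exact this.symm
  · intro hU σ hσ φ
    obtain ⟨g, hg⟩ := exists_smul_eq_apply σ hσ
    rw [h, h, ← funext hg, ← setOf_realize_smul]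
    exact (hU g _ (definable_univ_iff.2 ⟨φ, rfl⟩)).symm

theorem extends_tp_iff [Nonempty M] (h : Represents U p) (d : α → M) :
    Extends p (tp L d A) ↔ Realizes L U A d := by
  simp only [Extends, contains_tp, h.contains_relabel_coe_iff]
  constructor
  · intro H
    refine realizes_of_forall_mem fun s hs hsU => ?_
    obtain ⟨φ, rfl⟩ := Set.definable_iff_exists_formula_sum.1 hs
    by_contra hd
    exact Ultrafilter.compl_mem_iff_notMem.1 (H φ.not hd) hsU
  · exact fun H φ hφ => (H _ (definable_setOf_realize φ)).2 hφ

theorem realizesOver_iff (h : Represents U p) (v : α → M) :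
    RealizesOver A p v ↔ Realizes L U A v := by
  simp only [RealizesOver, h.contains_relabel_coe_iff]
  constructor
  · intro H
    refine realizes_of_forall_mem fun s hs hsU => ?_
    obtain ⟨φ, rfl⟩ := Set.definable_iff_exists_formula_sum.1 hs
    exact H φ hsU
  · exact fun H φ hφ => (H _ (definable_setOf_realize φ)).1 hφ

end Represents

end

end Represents

section InvariantExtensions

variable {M : Type w} [L.Structure M] {A B : Set M} {α β : Type*}

theorem exists_finset_of_definable {s : Set (α → M)} (hs : B.Definable L s) :
    ∃ (F : Finset α) (t : Set (F → M)), B.Definable L t ∧ s = (· ∘ (↑)) ⁻¹' t := by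
  classical
  obtain ⟨φ, rfl⟩ := Set.definable_iff_exists_formula_sum.1 hs
  let F : Finset α := φ.freeVarFinset.toRight
  have exists_var : ∀ x : φ.freeVarFinset, ∃ y : B ⊕ F, Sum.map id (↑) y = (x : B ⊕ α) := by
    rintro ⟨b | i, hx⟩
    exacts [⟨Sum.inl b, rfl⟩, ⟨Sum.inr ⟨i, Finset.mem_toRight.2 hx⟩, rfl⟩]
  choose f hf using exists_var
  refine ⟨F, _, definable_setOf_realize (φ.restrictFreeVar f), Set.ext fun v => ?_⟩
  refine (BoundedFormula.realize_restrictFreeVar _ fun x => ?_).symm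
  rw [← hf x, ← Function.comp_apply (f := Sum.elim _ _) (g := Sum.map _ _), Sum.elim_comp_map]
  rfl

theorem smul_preimage_comp (g : autFixing L A) (j : β → α) (s : Set (β → M)) :
    g • ((· ∘ j) ⁻¹' s : Set (α → M)) = (· ∘ j) ⁻¹' (g • s) := by
  ext v
  simp only [Set.mem_smul_set_iff_inv_smul_mem, Set.mem_preimage]
  rfl

theorem IsAutInvariant.reindex {U : Ultrafilter (α → M)} (h : IsAutInvariant L A U) (j : β → α) :
    IsAutInvariant L A (reindex U j) := by
  intro g s hs
  rw [mem_reindex, ← smul_preimage_comp]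
  exact h g _ (hs.preimage_comp j)

theorem Realizes.smul {U : Ultrafilter (α → M)} (hU : IsAutInvariant L A U) {v : α → M}
    (hv : Realizes L U B v) (g : autFixing L A) : Realizes L U (g • B) (g • v) := by
  intro s hs
  have hs' : B.Definable L (g⁻¹ • s) := by
    simpa only [inv_smul_smul] using definable_smul g⁻¹ hs
  rw [← hU g⁻¹ s (hs.mono (Set.subset_univ _)), hv _ hs', Set.mem_inv_smul_set_iff]

variable (L) in
/-- The `A`-invariant global types that extend `tp(e/A)`. The case that matters most is that of the
tuple `id` of all elements of `M`, whose extensions restrict to each tuple `c` of elements of `M`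
through `reindex`: these restrictions are the extendibly `A`-invariant extensions of `tp(c/A)`. -/
def invariantExtensions (A : Set M) (e : α → M) : Set (Ultrafilter (α → M)) :=
  {U | IsAutInvariant L A U ∧ Realizes L U A e}

variable {e : α → M} {U : Ultrafilter (α → M)}

theorem reindex_mem_invariantExtensions (h : U ∈ invariantExtensions L A e) (j : β → α) :
    reindex U j ∈ invariantExtensions L A (e ∘ j) :=
  ⟨h.1.reindex j, h.2.reindex j⟩

theorem invariantExtensions_smul (g : autFixing L A) (e : α → M) :
    invariantExtensions L A (g • e) = invariantExtensions L A e := by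
  refine Set.ext fun U => and_congr_right fun _ => forall₂_congr fun s hs => ?_
  rw [smul_mem_iff_of_definable g hs]

theorem reindex_smul_mem_invariantExtensions {R : Ultrafilter (M → M)}
    (hR : R ∈ invariantExtensions L A id) (g : autFixing L A) :
    reindex R (g • ·) ∈ invariantExtensions L A id := by
  rw [← invariantExtensions_smul g]
  exact reindex_mem_invariantExtensions hR _

theorem mem_invariantExtensions_iff_forall_finset :
    U ∈ invariantExtensions L A e ↔
      ∀ F : Finset α, reindex U (↑) ∈ invariantExtensions L A (e ∘ ((↑) : F → α)) := by
  refine ⟨fun h F => reindex_mem_invariantExtensions h _,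
    fun h => ⟨fun g s hs => ?_, fun s hs => ?_⟩⟩
  · obtain ⟨F, t, ht, rfl⟩ := exists_finset_of_definable hs
    rw [smul_preimage_comp]
    exact (h F).1 g t ht
  · obtain ⟨F, t, ht, rfl⟩ := exists_finset_of_definable hs
    exact (h F).2 t ht

theorem isClosed_setOf_reindex_mem_invariantExtensions (A : Set M) (e : β → M) (j : β → α) :
    IsClosed {U : Ultrafilter (α → M) | reindex U j ∈ invariantExtensions L A e} := by
  have isClopen_mem (s : Set (β → M)) : IsClopen {U : Ultrafilter (α → M) | s ∈ reindex U j} :=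
    ⟨ultrafilter_isClosed_basic _, ultrafilter_isOpen_basic _⟩
  have isClosed_iff {s t : Set (Ultrafilter (α → M))} (hs : IsClopen s) (ht : IsClopen t) :
      IsClosed {U | U ∈ s ↔ U ∈ t} := by
    simp only [iff_iff_implies_and_implies, Set.ofPred_and]
    exact (isClosed_imp hs.isOpen ht.isClosed).inter (isClosed_imp ht.isOpen hs.isClosed)
  have isClosed_isAutInvariant : IsClosed {U | IsAutInvariant L A (reindex U j)} := by
    simp only [IsAutInvariant, Set.ofPred_forall]
    exact isClosed_iInter fun g => isClosed_iInter fun s => isClosed_iInter fun _ =>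
      isClosed_iff (isClopen_mem _) (isClopen_mem s)
  have isClosed_realizes : IsClosed {U | Realizes L (reindex U j) A e} := by
    simp only [Realizes, Set.ofPred_forall]
    exact isClosed_iInter fun s => isClosed_iInter fun _ =>
      isClosed_iff (isClopen_mem s) ⟨isClosed_const, isOpen_const⟩
  exact isClosed_isAutInvariant.inter isClosed_realizes

theorem exists_mem_invariantExtensions_of_isClosed {C : Set (Ultrafilter (α → M))}
    (hC : IsClosed C)
    (h : ∀ F : Finset α, ∃ U ∈ C, reindex U (↑) ∈ invariantExtensions L A (e ∘ ((↑) : F → α))) :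
    ∃ U ∈ C, U ∈ invariantExtensions L A e := by
  classical
  let K (F : Finset α) : Set (Ultrafilter (α → M)) :=
    C ∩ {U | reindex U (↑) ∈ invariantExtensions L A (e ∘ ((↑) : F → α))}
  have isClosed_K (F : Finset α) : IsClosed (K F) :=
    hC.inter (isClosed_setOf_reindex_mem_invariantExtensions A _ _)
  have antitone_K : Antitone K := fun F F' hF U hU =>
    ⟨hU.1, reindex_mem_invariantExtensions hU.2 (Set.inclusion hF)⟩
  obtain ⟨U, hU⟩ := IsCompact.nonempty_iInter_of_directed_nonempty_isCompact_isClosed K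
    antitone_K.directed_ge h (fun F => (isClosed_K F).isCompact) isClosed_K
  rw [Set.mem_iInter] at hU
  exact ⟨U, (hU ∅).1, mem_invariantExtensions_iff_forall_finset.2 fun F => (hU F).2⟩

theorem exists_reindex_eq [Finite α] (h : Realizes L U A e) :
    ∃ W : Ultrafilter (M → M), reindex W e = U := by
  have eventually_factorsThrough : ∀ᶠ v in (U : Filter (α → M)), v.FactorsThrough e := by
    simp only [Function.FactorsThrough, Filter.eventually_all]
    intro i j hij
    have hdef : A.Definable L {v : α → M | v i = v j} := by
      simpa only [Formula.realize_equal, Term.realize_var, Sum.elim_inr] using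
        definable_setOf_realize ((Term.var (Sum.inr i)).equal (Term.var (Sum.inr j)))
    exact (h _ hdef).2 hij
  refine ⟨U.map fun v => Function.extend e v id, Ultrafilter.coe_injective ?_⟩
  refine (Filter.map_map ..).trans ((Filter.map_congr ?_).trans Filter.map_id)
  filter_upwards [eventually_factorsThrough] with v hv
  exact funext fun i => hv.extend_apply id i

end InvariantExtensions

section Extendible

variable {M : Type w} [L.Structure M] [Nonempty M] {A : Set M}

theorem IsInvarianceBase.invariantExtensions_nonempty (hA : IsInvarianceBase L A) :
    (invariantExtensions L A (id : M → M)).Nonempty := by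
  obtain ⟨R, -, hR⟩ := exists_mem_invariantExtensions_of_isClosed (L := L) (A := A)
    (e := (id : M → M)) isClosed_univ fun F => by
      let d : Fin F.card → M := (↑) ∘ F.equivFin.symm
      obtain ⟨p, hp, hpd⟩ := hA _ (tp L d A)
      obtain ⟨U, hU⟩ := exists_represents p
      have hUd : U ∈ invariantExtensions L A d :=
        ⟨hU.isInvariant_iff.1 hp, (hU.extends_tp_iff d).1 hpd⟩
      obtain ⟨W, rfl⟩ := exists_reindex_eq hUd.2
      have := reindex_mem_invariantExtensions hUd F.equivFin
      rw [reindex_reindex, Function.comp_assoc, F.equivFin.symm_comp_self] at this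
      exact ⟨W, trivial, this⟩
  exact ⟨R, hR⟩

variable {α : Type} [Finite α] {c : α → M} {p : GlobalType L M α}

theorem IsExtendiblyInvariant.exists_represents_reindex (hp : IsExtendiblyInvariant A p)
    (hpc : Extends p (tp L c A)) :
    ∃ R ∈ invariantExtensions L A id, Represents (reindex R c) p := by
  let C : Set (Ultrafilter (M → M)) := {R | Represents (reindex R c) p}
  have isClosed_C : IsClosed C := by
    simp only [C, Represents, Set.ofPred_forall]
    refine isClosed_iInter fun φ => ?_
    by_cases hφ : Contains p φ
    · simp only [hφ, true_iff]
      exact ultrafilter_isClosed_basic _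
    · simp only [hφ, false_iff]
      exact (ultrafilter_isOpen_basic _).isClosed_compl
  obtain ⟨V, hV⟩ := exists_represents p
  obtain ⟨R, hRp, hR⟩ := exists_mem_invariantExtensions_of_isClosed (L := L) (A := A)
    (e := (id : M → M)) isClosed_C fun F => by
      let d : Fin F.card → M := (↑) ∘ F.equivFin.symm
      obtain ⟨r, hr, hpr, hrd⟩ := hp _ (tp L (Sum.elim c d) A) fun φ hφ => by
        rw [contains_tp, Formula.realize_relabel, Sum.elim_comp_map]
        rw [hV.contains_relabel_coe_iff] at hφ
        exact ((hV.extends_tp_iff c).1 hpc _ (definable_setOf_realize φ)).1 hφ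
      obtain ⟨U, hU⟩ := exists_represents r
      have hUd : U ∈ invariantExtensions L A (Sum.elim c d) :=
        ⟨hU.isInvariant_iff.1 hr, (hU.extends_tp_iff _).1 hrd⟩
      obtain ⟨W, rfl⟩ := exists_reindex_eq hUd.2
      refine ⟨W, represents_of_forall_contains fun φ hφ => ?_, ?_⟩
      · have := (hU _).1 (hpr φ hφ)
        simp only [Formula.realize_relabel, Sum.elim_comp_map] at this
        exact this
      · have := reindex_mem_invariantExtensions hUd (Sum.inr ∘ F.equivFin)
        rw [reindex_reindex, ← Function.comp_assoc, Sum.elim_comp_inr, Function.comp_assoc,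
          F.equivFin.symm_comp_self] at this
        exact this
  exact ⟨R, hR, hRp⟩

theorem IsMonster.isExtendiblyInvariant_of_represents {κ : Cardinal.{w}} (hM : IsMonster L M κ)
    (hA : #A < κ) {R : Ultrafilter (M → M)} (hR : R ∈ invariantExtensions L A id)
    (hp : Represents (reindex R c) p) : IsExtendiblyInvariant A p := by
  intro n q hq
  obtain ⟨V, hV⟩ := exists_mem_ultrafilter_iff_contains (L := L) (C := A) q
  obtain ⟨v, hv⟩ := hM.exists_realizes hA V
  have hv_inl : Realizes L (reindex R c) A (v ∘ Sum.inl) := by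
    refine realizes_of_forall_mem fun s hs hsR => ?_
    obtain ⟨φ, rfl⟩ := Set.definable_iff_exists_formula_sum.1 hs
    have := (hV _).1 (hq φ ((hp.contains_relabel_coe_iff φ).2 hsR))
    simp only [Formula.realize_relabel, Sum.elim_comp_map] at this
    exact (hv _ (hs.preimage_comp Sum.inl)).1 this
  obtain ⟨g, hg : g • c = v ∘ Sum.inl⟩ :=
    hM.exists_smul_eq hA (reindex_mem_invariantExtensions hR c).2 hv_inl
  let d : Fin n → M := g⁻¹ • (v ∘ Sum.inr)
  have hd : g • Sum.elim c d = v := by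
    rw [smul_sumElim, hg, smul_inv_smul, Sum.elim_comp_inl_inr]
  obtain ⟨r, hr⟩ := exists_represents_of_ultrafilter (L := L) (reindex R (Sum.elim c d))
  have hrd := reindex_mem_invariantExtensions hR (Sum.elim c d)
  refine ⟨r, hr.isInvariant_iff.2 hrd.1, fun φ hφ => ?_, fun φ hφ => ?_⟩
  · rw [hr]
    simp only [Formula.realize_relabel, Sum.elim_comp_map]
    exact (hp φ).1 hφ
  · have hφ := definable_setOf_realize φ
    rw [hr.contains_relabel_coe_iff, hrd.2 _ hφ, Function.id_comp,
      ← smul_mem_iff_of_definable g hφ, hd, ← hv _ hφ]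
    exact (hV φ).1 ‹_›

end Extendible

section Entries

variable {M : Type w} {ι : Type*} {S T : Set (ι → M)} {v : ι → M}

/-- The set of entries of the tuples in `S`. -/
def entries (S : Set (ι → M)) : Set M :=
  ⋃ v ∈ S, Set.range v

theorem apply_mem_entries (hv : v ∈ S) (i : ι) : v i ∈ entries S :=
  Set.mem_biUnion hv ⟨i, rfl⟩

theorem entries_mono (h : S ⊆ T) : entries S ⊆ entries T :=
  Set.biUnion_subset_biUnion_left h

theorem finite_entries [Finite ι] (hS : S.Finite) : (entries S).Finite :=
  hS.biUnion fun v _ => Set.finite_range v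

theorem entries_setOf_mem_cons (v : ι → M) (l : List (ι → M)) :
    entries {w | w ∈ v :: l} = Set.range v ∪ entries {w | w ∈ l} := by
  simp only [List.mem_cons]
  exact Set.biUnion_insert v {w | w ∈ l} _

theorem range_smul {G : Type*} [SMul G M] (g : G) (v : ι → M) :
    Set.range (g • v) = g • Set.range v :=
  Set.range_comp (g • ·) v

theorem entries_image_smul {G J : Type*} [SMul G M] (g : G) (f : J → ι → M) (S : Set J) :
    entries ((fun j => g • f j) '' S) = g • entries (f '' S) := by
  simp only [entries, Set.biUnion_image, Set.smul_set_iUnion₂, range_smul]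

theorem entries_map_smul {G : Type*} [SMul G M] (g : G) (l : List (ι → M)) :
    entries {v | v ∈ l.map (g • ·)} = g • entries {v | v ∈ l} := by
  have := entries_image_smul g id {v | v ∈ l}
  rw [Set.image_id] at this
  rw [← this]
  exact congrArg entries (Set.ext fun v => List.mem_map)

theorem smul_entries_congr {G : Type*} [SMul G M] {g h : G} (hgh : ∀ v ∈ S, g • v = h • v) :
    g • entries S = h • entries S := by
  simp only [entries, Set.smul_set_iUnion₂, ← range_smul]
  exact Set.iUnion₂_congr fun v hv => by rw [hgh v hv]

theorem smul_eq_smul_of_entries {G : Type*} [SMul G M] {g h : G}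
    (hgh : ∀ x ∈ entries S, g • x = h • x) (hv : v ∈ S) : g • v = h • v :=
  funext fun i => hgh _ (apply_mem_entries hv i)

theorem Realizes.mono_entries [L.Structure M] {β : Type*} {U : Ultrafilter (β → M)}
    {A : Set M} {e : β → M} (h : Realizes L U (A ∪ entries T) e) (hST : S ⊆ T) :
    Realizes L U (A ∪ entries S) e :=
  h.mono (Set.union_subset_union_right _ (entries_mono hST))

theorem realizes_smul_of_realizes_entries [L.Structure M] {R : Ultrafilter (M → M)} {B : Set M}
    {G : Type*} [SMul G M] {g : G}
    (h : Realizes L (reindex R ((↑) : entries S → M)) B (g • ((↑) : entries S → M)))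
    (hv : v ∈ S) : Realizes L (reindex R v) B (g • v) :=
  h.reindex fun i => ⟨v i, apply_mem_entries hv i⟩

end Entries

section Homogeneity

variable {M : Type w} [L.Structure M] [Nonempty M] {κ : Cardinal.{w}} {A : Set M} {ι : Type*}
  [Finite ι]

theorem IsMonster.exists_smul_extending (hM : IsMonster L M κ) (hA : #A < κ)
    {U : Ultrafilter (ι → M)} (hU : IsAutInvariant L A U) {P : Set M} (hP : P.Finite)
    {u u' : ι → M} (hu : Realizes L U (A ∪ P) u) (h : autFixing L A)
    (hu' : Realizes L U (A ∪ h • P) u') :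
    ∃ g : autFixing L A, (∀ x ∈ P, g • x = h • x) ∧ g • u = u' := by
  have hhu := hu.smul hU h
  rw [Set.smul_set_union, smul_set_eq] at hhu
  obtain ⟨f, hf⟩ := hM.exists_smul_eq (hM.mk_union_lt hA hP.smul_set) hhu hu'
  refine ⟨Subgroup.inclusion (autFixing_anti Set.subset_union_left) f * h, fun x hx => ?_, ?_⟩
  · rw [mul_smul]
    exact smul_eq_of_mem f (Or.inr (Set.smul_mem_smul_set hx))
  · rw [mul_smul]
    exact hf

theorem IsMonster.exists_realizes_smul (hM : IsMonster L M κ) (hA : #A < κ)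
    {U : Ultrafilter (ι → M)} {e : ι → M} (hU : Realizes L U A e) {P : Set M} (hP : P.Finite) :
    ∃ g : autFixing L A, Realizes L U (A ∪ P) (g • e) := by
  obtain ⟨v, hv⟩ := hM.exists_realizes (hM.mk_union_lt hA hP) U
  obtain ⟨g, rfl⟩ := hM.exists_smul_eq hA hU (hv.mono Set.subset_union_left)
  exact ⟨g, hv⟩

end Homogeneity

section Substitutable

variable {M : Type w} [L.Structure M] {A : Set M} {ι : Type*} {c : ι → M}

variable (L) in
/-- A list of conjugates of `c` over `A` such that, for each tuple `v` in it, any finitely many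
conjugates of `c` can be substituted for `v` over one common conjugate of the tuples after `v`. -/
def IsSubstitutable (A : Set M) (c : ι → M) : List (ι → M) → Prop
  | [] => True
  | v :: l => IsSubstitutable A c l ∧ v ∈ MulAction.orbit (autFixing L A) c ∧
      ∀ U : Finset (ι → M), ↑U ⊆ MulAction.orbit (autFixing L A) c →
        ∃ k : autFixing L A, ∀ u ∈ U, ∃ h : autFixing L A, h • v = u ∧ ∀ w ∈ l, h • w = k • w

theorem isSubstitutable_singleton : IsSubstitutable L A c [c] := by
  refine ⟨trivial, MulAction.mem_orbit_self c, fun U hU => ⟨1, fun u hu => ?_⟩⟩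
  obtain ⟨h, rfl⟩ := hU hu
  exact ⟨h, rfl, fun w hw => absurd hw List.not_mem_nil⟩

theorem IsSubstitutable.mem_orbit {l : List (ι → M)} (hl : IsSubstitutable L A c l) {v : ι → M}
    (hv : v ∈ l) : v ∈ MulAction.orbit (autFixing L A) c := by
  induction hv with
  | head => exact hl.2.1
  | tail _ _ ih => exact ih hl.1

theorem IsSubstitutable.map_smul {l : List (ι → M)} (hl : IsSubstitutable L A c l)
    (g : autFixing L A) : IsSubstitutable L A c (l.map (g • ·)) := by
  induction l with
  | nil => trivial
  | cons v l ih =>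
    obtain ⟨hl, hv, hsubst⟩ := hl
    refine ⟨ih hl, MulAction.mapsTo_smul_orbit g c hv, fun U hU => ?_⟩
    obtain ⟨k, hk⟩ := hsubst U hU
    refine ⟨k * g⁻¹, fun u hu => ?_⟩
    obtain ⟨h, rfl, hw⟩ := hk u hu
    refine ⟨h * g⁻¹, by rw [mul_smul, inv_smul_smul], List.forall_mem_map.2 fun w hwl => ?_⟩
    rw [mul_smul, mul_smul, inv_smul_smul, hw w hwl]

theorem IsSubstitutable.append [Nonempty M] [Finite ι] {κ : Cardinal.{w}} (hM : IsMonster L M κ)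
    (hA : #A < κ) {l₁ l₂ : List (ι → M)} (h₁ : IsSubstitutable L A c l₁)
    (h₂ : IsSubstitutable L A c l₂) {β : Type*} [Finite β] {W : Ultrafilter (β → M)}
    (hW : IsAutInvariant L A W) {e : β → M} (he : entries {v | v ∈ l₂} ⊆ Set.range e)
    (heW : Realizes L W (A ∪ entries {v | v ∈ l₁}) e) :
    IsSubstitutable L A c (l₁ ++ l₂) := by
  induction l₁ with
  | nil => exact h₂
  | cons v l ih =>
    obtain ⟨hl, hv, hsubst⟩ := h₁
    have heW_tail : Realizes L W (A ∪ entries {w | w ∈ l}) e :=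
      heW.mono_entries fun _ => List.mem_cons_of_mem v
    refine ⟨ih hl heW_tail, hv, fun U hU => ?_⟩
    obtain ⟨k, hk⟩ := hsubst U hU
    have finite_tail := finite_entries (List.finite_toSet l)
    obtain ⟨e', he'⟩ := hM.exists_realizes (hM.mk_union_lt hA
      ((finite_entries U.finite_toSet).union (finite_tail.smul_set (a := k)))) W
    obtain ⟨k', hk'_tail, hk'e⟩ := hM.exists_smul_extending hA hW finite_tail heW_tail k
      (he'.mono (Set.union_subset_union_right _ Set.subset_union_right))
    refine ⟨k', fun u hu => ?_⟩
    obtain ⟨h, hhv, hh⟩ := hk u hu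
    have smul_entries_subset : h • entries {w | w ∈ v :: l} ⊆
        entries (U : Set (ι → M)) ∪ k • entries {w | w ∈ l} := by
      rw [entries_setOf_mem_cons, Set.smul_set_union, ← range_smul, hhv]
      exact Set.union_subset_union (Set.subset_biUnion_of_mem (u := Set.range) hu)
        (smul_entries_congr hh).subset
    obtain ⟨h', hh'_cons, hh'e⟩ := hM.exists_smul_extending hA hW
      (finite_entries (List.finite_toSet (v :: l))) heW h
      (he'.mono (Set.union_subset_union_right _ smul_entries_subset))
    refine ⟨h', ?_, fun w hw => ?_⟩
    · rw [← hhv]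
      exact smul_eq_smul_of_entries hh'_cons List.mem_cons_self
    · rcases List.mem_append.1 hw with hw | hw
      · rw [smul_eq_smul_of_entries hh'_cons (List.mem_cons_of_mem v hw), hh w hw,
          smul_eq_smul_of_entries hk'_tail hw]
      · refine funext fun i => ?_
        obtain ⟨j, hj⟩ := he (apply_mem_entries hw i)
        rw [Pi.smul_apply, Pi.smul_apply, ← hj]
        exact congrFun (hh'e.trans hk'e.symm) j

end Substitutable

section Universal

variable {M : Type w} [L.Structure M] {A : Set M} {ι : Type*} {c : ι → M} {s t : Set (ι → M)}

variable (L) in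
/-- Among finitely many fixed conjugates of `c` over `A` there is always one whose type in a given
`A`-invariant extension of `tp(M/A)` does not contain `s`. -/
def IsAvoidable (A : Set M) (c : ι → M) (s : Set (ι → M)) : Prop :=
  ∃ U : Finset (ι → M), ↑U ⊆ MulAction.orbit (autFixing L A) c ∧
    ∀ R ∈ invariantExtensions L A id, ∃ u ∈ U, s ∉ reindex R u

theorem isAvoidable_empty : IsAvoidable L A c ∅ :=
  ⟨{c}, Finset.coe_singleton c ▸ Set.singleton_subset_iff.2 (MulAction.mem_orbit_self c),
    fun R _ => ⟨c, Finset.mem_singleton_self c, (reindex R c).empty_notMem⟩⟩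

theorem IsAvoidable.exists_finset_forall_mem (ht : IsAvoidable L A c t) (s : Set (ι → M))
    {l : List (ι → M)} (hl : IsSubstitutable L A c l) :
    ∃ (V : Finset (ι → M)) (Γ : Finset (autFixing L A)),
      ↑V ⊆ MulAction.orbit (autFixing L A) c ∧
      ∀ R ∈ invariantExtensions L A id, (∀ u ∈ V, s ∪ t ∈ reindex R u) →
        ∃ g ∈ Γ, ∀ v ∈ l, s ∈ reindex R (g • v) := by
  classical
  obtain ⟨U, hU, hUt⟩ := ht
  induction l with
  | nil => exact ⟨∅, {1}, by simp, by simp⟩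
  | cons v l ih =>
    obtain ⟨hl, -, hsubst⟩ := hl
    obtain ⟨V, Γ, hV, hΓ⟩ := ih hl
    obtain ⟨k, hk⟩ := hsubst U hU
    choose! h hhv hhl using hk
    refine ⟨V ∪ Finset.image₂ (fun g u => (g * k⁻¹) • u) Γ U,
      Finset.image₂ (fun g u => g * k⁻¹ * h u) Γ U, ?_, fun R hR hV_mem => ?_⟩
    · rw [Finset.coe_union, Finset.coe_image₂, Set.union_subset_iff, Set.image2_subset_iff]
      exact ⟨hV, fun g _ u hu => MulAction.mapsTo_smul_orbit _ c (hU hu)⟩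
    · obtain ⟨g, hg, hgl⟩ := hΓ R hR fun u hu => hV_mem u (Finset.mem_union_left _ hu)
      obtain ⟨u, hu, hut⟩ := hUt _ (reindex_smul_mem_invariantExtensions hR (g * k⁻¹))
      have hus : s ∈ reindex R ((g * k⁻¹) • u) :=
        (Ultrafilter.union_mem_iff.1 (hV_mem _
          (Finset.mem_union_right _ (Finset.mem_image₂_of_mem hg hu)))).resolve_right hut
      refine ⟨_, Finset.mem_image₂_of_mem hg hu, List.forall_mem_cons.2 ⟨?_, fun w hw => ?_⟩⟩
      · rwa [mul_smul, hhv u hu]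
      · rw [mul_smul, hhl u hu w hw, mul_smul, inv_smul_smul]
        exact hgl w hw

theorem IsAvoidable.union (ht : IsAvoidable L A c t) {l : List (ι → M)}
    (hl : IsSubstitutable L A c l)
    (hs : ∀ R ∈ invariantExtensions L A id, ∃ v ∈ l, s ∉ reindex R v) :
    IsAvoidable L A c (s ∪ t) := by
  obtain ⟨V, Γ, hV, hΓ⟩ := ht.exists_finset_forall_mem s hl
  refine ⟨V, hV, fun R hR => ?_⟩
  by_contra! hmem
  obtain ⟨g, -, hg⟩ := hΓ R hR hmem
  obtain ⟨v, hv, hvs⟩ := hs _ (reindex_smul_mem_invariantExtensions hR g)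
  exact hvs (hg v hv)

theorem exists_forall_reindex_eq {V : Ultrafilter (ι → M)} {l : List (ι → M)}
    (h : ∀ s ∈ V, ∃ R ∈ invariantExtensions L A id, ∀ v ∈ l, s ∈ reindex R v) :
    ∃ R ∈ invariantExtensions L A id, ∀ v ∈ l, reindex R v = V := by
  let K (s : {s // s ∈ V}) : Set (Ultrafilter (M → M)) :=
    invariantExtensions L A id ∩ ⋂ v ∈ l, {R | s.1 ∈ reindex R v}
  have monotone_K : Monotone K := fun s t hst => Set.inter_subset_inter_right _
    (Set.iInter₂_mono fun v _ R hR => Filter.mem_of_superset hR (Set.preimage_mono hst))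
  have isClosed_K (s : {s // s ∈ V}) : IsClosed (K s) :=
    (isClosed_setOf_reindex_mem_invariantExtensions A id id).inter
      (isClosed_biInter fun v _ => ultrafilter_isClosed_basic _)
  have directed_K : Directed (· ⊇ ·) K := fun s t =>
    ⟨⟨s.1 ∩ t.1, Filter.inter_mem s.2 t.2⟩, monotone_K Set.inter_subset_left,
      monotone_K Set.inter_subset_right⟩
  have nonempty_K (s : {s // s ∈ V}) : (K s).Nonempty := by
    obtain ⟨R, hR, hRs⟩ := h s.1 s.2
    exact ⟨R, hR, Set.mem_iInter₂.2 hRs⟩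
  have : Nonempty {s // s ∈ V} := ⟨⟨Set.univ, Filter.univ_mem⟩⟩
  obtain ⟨R, hR⟩ := IsCompact.nonempty_iInter_of_directed_nonempty_isCompact_isClosed K directed_K
    nonempty_K (fun s => (isClosed_K s).isCompact) isClosed_K
  rw [Set.mem_iInter] at hR
  refine ⟨R, (hR ⟨Set.univ, Filter.univ_mem⟩).1, fun v hv => ?_⟩
  exact Ultrafilter.coe_le_coe.1 fun s hs => Set.mem_iInter₂.1 (hR ⟨s, hs⟩).2 v hv

variable (L) in
/-- All tuples of any substitutable list can simultaneously have the type that `R` gives to `c`. -/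
def IsUniversal (A : Set M) (c : ι → M) (R : Ultrafilter (M → M)) : Prop :=
  ∀ l, IsSubstitutable L A c l →
    ∃ R' ∈ invariantExtensions L A id, ∀ v ∈ l, reindex R' v = reindex R c

theorem exists_mem_of_not_isUniversal {R : Ultrafilter (M → M)} (hR : ¬IsUniversal L A c R) :
    ∃ s ∈ reindex R c, ∃ l, IsSubstitutable L A c l ∧
      ∀ R' ∈ invariantExtensions L A id, ∃ v ∈ l, s ∉ reindex R' v := by
  obtain ⟨l, hl, hlR⟩ : ∃ l, IsSubstitutable L A c l ∧
      ∀ R' ∈ invariantExtensions L A id, ∃ v ∈ l, reindex R' v ≠ reindex R c := by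
    simpa only [IsUniversal, not_forall, not_exists, not_and, exists_prop] using hR
  by_contra! h
  obtain ⟨R', hR', hR'l⟩ := exists_forall_reindex_eq fun s hs => h s hs l hl
  obtain ⟨v, hv, hne⟩ := hlR R' hR'
  exact hne (hR'l v hv)

theorem exists_isUniversal (hne : (invariantExtensions L A (id : M → M)).Nonempty) (c : ι → M) :
    ∃ R ∈ invariantExtensions L A id, IsUniversal L A c R := by
  by_contra! not_isUniversal
  obtain ⟨s, avoidable_union, mem_reindex_c⟩ :
      ∃ s : Set (ι → M), (∀ t, IsAvoidable L A c t → IsAvoidable L A c (s ∪ t)) ∧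
        ∀ R ∈ invariantExtensions L A id, s ∈ reindex R c := by
    have isCompact_invariantExtensions : IsCompact (invariantExtensions L A (id : M → M)) :=
      (isClosed_setOf_reindex_mem_invariantExtensions A id id).isCompact
    refine isCompact_invariantExtensions.induction_on
      (p := fun K => ∃ s : Set (ι → M), (∀ t, IsAvoidable L A c t → IsAvoidable L A c (s ∪ t)) ∧
        ∀ R ∈ K, s ∈ reindex R c) ?_ ?_ ?_ ?_
    · exact ⟨∅, fun t ht => by rwa [Set.empty_union], fun R hR => hR.elim⟩
    · exact fun K K' hK ⟨s, hs, hsK⟩ => ⟨s, hs, fun R hR => hsK R (hK hR)⟩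
    · rintro K K' ⟨s, hs, hsK⟩ ⟨s', hs', hsK'⟩
      refine ⟨s ∪ s', fun t ht => by rw [Set.union_assoc]; exact hs _ (hs' t ht), ?_⟩
      rintro R (hR | hR)
      · exact Filter.mem_of_superset (hsK R hR) Set.subset_union_left
      · exact Filter.mem_of_superset (hsK' R hR) Set.subset_union_right
    · intro R hR
      obtain ⟨s, hs, l, hl, hsl⟩ := exists_mem_of_not_isUniversal (not_isUniversal R hR)
      exact ⟨{R' | s ∈ reindex R' c}, mem_nhdsWithin_of_mem_nhds
        ((ultrafilter_isOpen_basic _).mem_nhds hs), s, fun t ht => ht.union hl hsl,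
        fun R' hR' => hR'⟩
  obtain ⟨U, hU, hUs⟩ := avoidable_union ∅ isAvoidable_empty
  obtain ⟨R, hR⟩ := hne
  obtain ⟨u, hu, hus⟩ := hUs R hR
  obtain ⟨g, rfl⟩ := hU hu
  rw [Set.union_empty] at hus
  exact hus (mem_reindex_c _ (reindex_smul_mem_invariantExtensions hR g))

end Universal

section MorleyLists

variable {M : Type w} [L.Structure M] {ι : Type*} {U : Ultrafilter (ι → M)} {A B : Set M}

variable (L) in
/-- Finite Morley sequences over `B` generated by `U`; the tuple realized last comes first. -/
def MorleyList (U : Ultrafilter (ι → M)) (B : Set M) : List (ι → M) → Prop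
  | [] => True
  | v :: l => MorleyList U B l ∧ Realizes L U (B ∪ entries {w | w ∈ l}) v

theorem MorleyList.sublist {l l' : List (ι → M)} (h : l'.Sublist l) (hl : MorleyList L U B l) :
    MorleyList L U B l' := by
  induction h with
  | slnil => trivial
  | cons v _ ih => exact ih hl.1
  | cons_cons v h ih =>
    exact ⟨ih hl.1, hl.2.mono_entries fun _ => h.mem⟩

theorem morleyList_singleton {v : ι → M} : MorleyList L U B [v] ↔ Realizes L U B v := by
  simp [MorleyList, entries]

theorem MorleyList.realizes {l : List (ι → M)} (hl : MorleyList L U B l) {v : ι → M}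
    (hv : v ∈ l) : Realizes L U B v :=
  morleyList_singleton.1 (hl.sublist (List.singleton_sublist.2 hv))

theorem morleyList_map {J : Type*} {f : J → ι → M} {r : J → J → Prop} {S : List J}
    (hS : S.Pairwise r) (hf : ∀ i ∈ S, Realizes L U (B ∪ entries (f '' {j | r i j})) (f i)) :
    MorleyList L U B (S.map f) := by
  induction S with
  | nil => trivial
  | cons i S ih =>
    obtain ⟨hi, hS⟩ := List.pairwise_cons.1 hS
    refine ⟨ih hS fun j hj => hf j (List.mem_cons_of_mem i hj),
      (hf i List.mem_cons_self).mono_entries ?_⟩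
    exact List.forall_mem_map.2 fun j hj => Set.mem_image_of_mem f (hi j hj)

theorem MorleyList.exists_map_eq [Nonempty M] [Finite ι] {κ : Cardinal.{w}} (hM : IsMonster L M κ)
    (hA : #A < κ) (hU : IsAutInvariant L A U) {l l' : List (ι → M)}
    (hlen : l.length = l'.length) (hl : MorleyList L U A l) (hl' : MorleyList L U A l') :
    ∃ g : autFixing L A, l.map (g • ·) = l' := by
  induction l generalizing l' with
  | nil => exact ⟨1, (List.length_eq_zero_iff.1 hlen.symm).symm⟩
  | cons v l ih =>
    obtain ⟨v', l', rfl⟩ := List.exists_cons_of_length_eq_add_one hlen.symm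
    obtain ⟨h, rfl⟩ := ih (Nat.succ_injective hlen) hl.1 hl'.1
    have hv' := hl'.2
    rw [entries_map_smul] at hv'
    obtain ⟨g, hg, rfl⟩ :=
      hM.exists_smul_extending hA hU (finite_entries (List.finite_toSet l)) hl.2 h hv'
    exact ⟨g, congrArg (_ :: ·) (List.map_congr_left fun w => smul_eq_smul_of_entries hg)⟩

variable (L) in
/-- The analogue of `IsMorleySequence` for the type represented by an ultrafilter. -/
def IsUltrafilterMorleySequence (U : Ultrafilter (ι → M)) (B : Set M) (f : ℕ → ι → M) : Prop :=
  ∀ i, Realizes L U (B ∪ ⋃ j < i, Set.range (f j)) (f i)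

theorem Represents.isMorleySequence_iff {α : Type} {p : GlobalType L M α}
    {U : Ultrafilter (α → M)} (h : Represents U p) {f : ℕ → α → M} :
    IsMorleySequence A p f ↔ IsUltrafilterMorleySequence L U A f :=
  forall_congr' fun i => h.realizesOver_iff (f i)

theorem exists_isUltrafilterMorleySequence [Nonempty M] [Finite ι] {κ : Cardinal.{w}}
    (hM : IsMonster L M κ) (U : Ultrafilter (ι → M)) (hB : #B < κ) :
    ∃ f, IsUltrafilterMorleySequence L U B f := by
  classical
  obtain ⟨f, hf, hmem⟩ := exists_seq_of_forall_finset_exists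
    (fun x : (ι → M) × Finset (ι → M) => Realizes L U (B ∪ entries (x.2 : Set (ι → M))) x.1)
    (fun x y => x.1 ∈ y.2) fun s _ => by
      obtain ⟨v, hv⟩ := hM.exists_realizes
        (hM.mk_union_lt hB (finite_entries (s.image Prod.fst).finite_toSet)) U
      exact ⟨(v, s.image Prod.fst), hv, fun x hx => Finset.mem_image_of_mem _ hx⟩
  exact ⟨fun i => (f i).1, fun i => (hf i).mono (Set.union_subset_union_right _
    (Set.iUnion₂_subset fun j hj => Set.subset_biUnion_of_mem (u := Set.range) (hmem j i hj)))⟩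

theorem IsUltrafilterMorleySequence.reindex {f : ℕ → ι → M}
    (hf : IsUltrafilterMorleySequence L U B f) {β : Type*} (j : β → ι) :
    IsUltrafilterMorleySequence L (reindex U j) B fun i => f i ∘ j :=
  fun i => ((hf i).reindex j).mono (Set.union_subset_union_right _
    (Set.iUnion₂_mono fun n _ => Set.range_comp_subset_range j (f n)))

theorem IsUltrafilterMorleySequence.morleyList {f : ℕ → ι → M}
    (hf : IsUltrafilterMorleySequence L U B f) (s : Finset ℕ) :
    MorleyList L U B ((s.sort (· ≥ ·)).map f) := by
  refine morleyList_map (s.sortedGT_sort).pairwise fun i _ => ?_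
  simp only [entries, Set.biUnion_image]
  exact hf i

end MorleyLists

section MorleyInconsistent

variable {M : Type w} [L.Structure M] {ι β : Type*} {U : Ultrafilter (ι → M)} {A : Set M}
  {ψ : L.Formula (β ⊕ ι)}

/-- The formulas `ψ(x, v)` for `v` in `S` are satisfied by one tuple. -/
def JointlySatisfiable (ψ : L.Formula (β ⊕ ι)) (S : Set (ι → M)) : Prop :=
  ∃ a : β → M, ∀ v ∈ S, ψ.Realize (Sum.elim a v)

theorem isConsistent_iff_jointlySatisfiable {α γ : Type} {J : Type} {φ : L.Formula (α ⊕ γ)}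
    {f : J → γ → M} {S : Set J} :
    IsConsistent φ f S ↔ ∀ s : Finset J, ↑s ⊆ S → JointlySatisfiable φ (f '' s) := by
  simp only [IsConsistent, JointlySatisfiable, Set.forall_mem_image, Finset.mem_coe]

theorem JointlySatisfiable.map_smul {l : List (ι → M)} (h : JointlySatisfiable ψ {v | v ∈ l})
    (g : autFixing L A) : JointlySatisfiable ψ {v | v ∈ l.map (g • ·)} := by
  obtain ⟨a, ha⟩ := h
  refine ⟨g • a, List.forall_mem_map.2 fun v hv => ?_⟩
  rw [← smul_sumElim, realize_smul]
  exact ha v hv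

variable (U A) in
/-- `U`-Morley sequences over `A` of some fixed finite length make `ψ(x, ·)` inconsistent. For the
ultrafilter of an invariant type, this says that `ψ` Kim-divides along that type. -/
def MorleyInconsistent (ψ : L.Formula (β ⊕ ι)) : Prop :=
  ∃ k, ∀ l, l.length = k → MorleyList L U A l → ¬JointlySatisfiable ψ {v | v ∈ l}

theorem MorleyInconsistent.of_imp_exists {J : Type*} [Finite J] {ψ : J → L.Formula (β ⊕ ι)}
    (hψ : ∀ i, MorleyInconsistent U A (ψ i)) {φ : L.Formula (β ⊕ ι)}
    (h : ∀ v, Realizes L U A v → ∀ a : β → M, φ.Realize (Sum.elim a v) →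
      ∃ i, (ψ i).Realize (Sum.elim a v)) :
    MorleyInconsistent U A φ := by
  classical
  cases nonempty_fintype J
  choose k hk using hψ
  refine ⟨∑ i, k i + 1, ?_⟩
  rintro l hlen hl ⟨a, ha⟩
  have exists_color : ∀ v ∈ l, ∃ i, (ψ i).Realize (Sum.elim a v) := fun v hv =>
    h v (hl.realizes hv) a (ha v hv)
  have : Nonempty J := by
    obtain ⟨v, hv⟩ := List.exists_mem_of_length_eq_add_one hlen
    exact (exists_color v hv).nonempty
  choose! color hcolor using exists_color
  have sum_length : ∑ i, (l.filter (color · = i)).length = l.length := by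
    have := Multiset.sum_count_eq_card (m := (l.map color : Multiset J))
      fun i _ => Finset.mem_univ i
    simpa only [← List.countP_eq_length_filter, Multiset.coe_count, List.count, List.countP_map,
      Function.comp_def, beq_eq_decide, Multiset.coe_card, List.length_map] using this
  obtain ⟨i, -, hi⟩ := Finset.exists_lt_of_sum_lt
    ((Nat.lt_succ_self (∑ i, k i)).trans_eq (hlen.symm.trans sum_length.symm))
  refine hk i _ (List.length_take_of_le hi.le)
    (hl.sublist ((List.take_sublist _ _).trans List.filter_sublist)) ⟨a, fun v hv => ?_⟩
  obtain ⟨hvl, hvi⟩ := List.mem_filter.1 (List.mem_of_mem_take hv)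
  exact of_decide_eq_true hvi ▸ hcolor v hvl

variable [Nonempty M] [Finite ι] {κ : Cardinal.{w}}

theorem MorleyList.jointlySatisfiable (hM : IsMonster L M κ) (hA : #A < κ)
    (hU : IsAutInvariant L A U) (hψ : ¬MorleyInconsistent U A ψ) {l : List (ι → M)}
    (hl : MorleyList L U A l) : JointlySatisfiable ψ {v | v ∈ l} := by
  simp only [MorleyInconsistent, not_exists, not_forall, not_not] at hψ
  obtain ⟨l', hlen, hl', hψl'⟩ := hψ l.length
  obtain ⟨g, rfl⟩ := hl'.exists_map_eq hM hA hU hlen hl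
  exact hψl'.map_smul g

theorem IsUltrafilterMorleySequence.morleyInconsistent_iff {ι β : Type} [Finite ι]
    {U : Ultrafilter (ι → M)} {ψ : L.Formula (β ⊕ ι)} (hM : IsMonster L M κ) (hA : #A < κ)
    (hU : IsAutInvariant L A U) {f : ℕ → ι → M} (hf : IsUltrafilterMorleySequence L U A f) :
    MorleyInconsistent U A ψ ↔ ¬IsConsistent ψ f Set.univ := by
  have image_eq (s : Finset ℕ) : f '' s = {v | v ∈ (s.sort (· ≥ ·)).map f} := by
    ext v
    simp only [Set.mem_image, Finset.mem_coe, Set.mem_ofPred_eq, List.mem_map, Finset.mem_sort]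
  simp only [isConsistent_iff_jointlySatisfiable, Set.subset_univ, true_imp_iff, image_eq]
  constructor
  · rintro ⟨k, hk⟩ hcon
    refine hk _ ?_ (hf.morleyList (Finset.range k)) (hcon (Finset.range k))
    rw [List.length_map, Finset.length_sort, Finset.card_range]
  · intro hcon
    by_contra hψ
    exact hcon fun s => (hf.morleyList s).jointlySatisfiable hM hA hU hψ

theorem morleyInconsistent_relabel_iff {ι γ β : Type} [Finite ι] [Finite γ]
    {U : Ultrafilter (ι → M)} {ψ : L.Formula (β ⊕ γ)} (hM : IsMonster L M κ) (hA : #A < κ)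
    (hU : IsAutInvariant L A U) (j : γ → ι) :
    MorleyInconsistent U A (ψ.relabel (Sum.map id j)) ↔ MorleyInconsistent (reindex U j) A ψ := by
  obtain ⟨f, hf⟩ := exists_isUltrafilterMorleySequence hM U hA
  rw [hf.morleyInconsistent_iff hM hA hU,
    (hf.reindex j).morleyInconsistent_iff hM hA (hU.reindex j)]
  simp only [IsConsistent, Formula.realize_relabel, Sum.elim_comp_map, Function.comp_id]

end MorleyInconsistent

section Trees

variable {M : Type w} [L.Structure M] {ι : Type*} {A : Set M} {Up Uq : Ultrafilter (ι → M)}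
  {n : ℕ} {t : List Bool → ι → M}

variable (L) in
/-- In the part of the tree `t` of height `n`, every node realizes `Up` over the nodes above it,
and every node that branches off to the left at `σ` realizes `Uq` over the nodes that branch off
to the right at `σ`. Extracted from it: Morley sequences of `Up` along paths and of `Uq` along
right-combs. -/
structure IsCombTree (A : Set M) (Up Uq : Ultrafilter (ι → M)) (n : ℕ) (t : List Bool → ι → M) :
    Prop where
  realizes_path : ∀ σ, σ.length < n →
    Realizes L Up (A ∪ entries (t '' {τ | σ <+: τ ∧ τ ≠ σ ∧ τ.length < n})) (t σ)
  realizes_comb : ∀ σ τ, σ ++ [false] <+: τ → τ.length < n →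
    Realizes L Uq (A ∪ entries (t '' {ρ | σ ++ [true] <+: ρ ∧ ρ.length < n})) (t τ)

theorem IsCombTree.smul (h : IsCombTree L A Up Uq n t) (hUp : IsAutInvariant L A Up)
    (hUq : IsAutInvariant L A Uq) (g : autFixing L A) :
    IsCombTree L A Up Uq n fun σ => g • t σ where
  realizes_path σ hσ := by
    have := (h.realizes_path σ hσ).smul hUp g
    rwa [Set.smul_set_union, smul_set_eq, ← entries_image_smul] at this
  realizes_comb σ τ hτ hlen := by
    have := (h.realizes_comb σ τ hτ hlen).smul hUq g
    rwa [Set.smul_set_union, smul_set_eq, ← entries_image_smul] at this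

theorem isCombTree_zero : IsCombTree L A Up Uq 0 t :=
  ⟨fun _ h => absurd h (Nat.not_lt_zero _), fun _ _ _ h => absurd h (Nat.not_lt_zero _)⟩

theorem isCombTree_succ (hsubtree : ∀ b, IsCombTree L A Up Uq n fun σ => t (b :: σ))
    (hroot : Realizes L Up (A ∪ entries (t '' {σ | σ ≠ [] ∧ σ.length < n + 1})) (t []))
    (hcomb : ∀ σ, σ.length < n →
      Realizes L Uq (A ∪ entries ((fun σ => t (true :: σ)) '' {σ | σ.length < n}))
        (t (false :: σ))) :
    IsCombTree L A Up Uq (n + 1) t where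
  realizes_path σ hσ := by
    rcases σ with _ | ⟨b, σ⟩
    · exact hroot.mono_entries (Set.image_mono fun τ hτ => hτ.2)
    · refine ((hsubtree b).realizes_path σ (Nat.succ_lt_succ_iff.1 hσ)).mono_entries ?_
      rintro _ ⟨_, ⟨⟨ρ, rfl⟩, hne, hlen⟩, rfl⟩
      exact ⟨σ ++ ρ, ⟨⟨ρ, rfl⟩, fun h => hne (congrArg (b :: ·) h),
        Nat.succ_lt_succ_iff.1 hlen⟩, rfl⟩
  realizes_comb σ τ hτ hlen := by
    obtain ⟨τ, rfl⟩ := hτ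
    rcases σ with _ | ⟨b, σ⟩
    · refine (hcomb τ (Nat.succ_lt_succ_iff.1 hlen)).mono_entries ?_
      rintro _ ⟨_, ⟨⟨ρ, rfl⟩, hρ⟩, rfl⟩
      exact ⟨ρ, Nat.succ_lt_succ_iff.1 hρ, rfl⟩
    · refine ((hsubtree b).realizes_comb σ _ ⟨τ, rfl⟩ (Nat.succ_lt_succ_iff.1 hlen)).mono_entries ?_
      rintro _ ⟨_, ⟨⟨ρ, rfl⟩, hρ⟩, rfl⟩
      exact ⟨_, ⟨⟨ρ, rfl⟩, Nat.succ_lt_succ_iff.1 hρ⟩, rfl⟩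

theorem IsCombTree.morleyList_path (h : IsCombTree L A Up Uq n t) (α : ℕ → Bool) {s : Finset ℕ}
    (hs : ∀ i ∈ s, i < n) :
    MorleyList L Up A ((s.sort (· ≤ ·)).map fun i => t ((List.range i).map α)) := by
  refine morleyList_map (r := fun i j => i < j ∧ j < n) ?_ fun i hi => ?_
  · exact (s.sortedLT_sort.pairwise.imp_of_mem fun _ hj hij =>
      ⟨hij, hs _ ((Finset.mem_sort _).1 hj)⟩)
  · refine (h.realizes_path _ ?_).mono_entries ?_
    · simpa using hs i ((Finset.mem_sort _).1 hi)
    · rintro _ ⟨j, ⟨hij, hj⟩, rfl⟩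
      refine ⟨_, ⟨?_, fun heq => hij.ne ?_, by simpa using hj⟩, rfl⟩
      · obtain ⟨m, rfl⟩ := Nat.exists_eq_add_of_le hij.le
        rw [List.range_add, List.map_append]
        exact List.prefix_append _ _
      · simpa using (congrArg List.length heq).symm

theorem IsRightComb.finset_induction {p : Finset (List Bool) → Prop} (empty : p ∅)
    (singleton : ∀ σ, p {σ})
    (insert : ∀ σ τ s, σ ++ [false] <+: τ → (∀ ρ ∈ s, σ ++ [true] <+: ρ) → p s → p (insert τ s))
    {X : Set (List Bool)} (hX : IsRightComb X) (s : Finset (List Bool)) (hs : ↑s ⊆ X) : p s := by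
  classical
  induction hX generalizing s with
  | subsingleton X hX =>
    obtain rfl | ⟨σ, hσ⟩ := s.eq_empty_or_nonempty
    · exact empty
    · rw [Finset.eq_singleton_iff_unique_mem.2 ⟨hσ, fun τ hτ => hX (hs hτ) (hs hσ)⟩]
      exact singleton σ
  | step X σ hext hleft _ ih =>
    obtain ⟨τ, hτ⟩ := hleft
    let right := s.filter (σ ++ [true] <+: ·)
    have right_holds : p right := ih right fun ρ hρ =>
      ⟨hs (Finset.mem_of_mem_filter ρ hρ), (Finset.mem_filter.1 hρ).2⟩
    have eq_or_right : ∀ ρ ∈ s, ρ = τ ∨ σ ++ [true] <+: ρ := by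
      intro ρ hρ
      obtain ⟨⟨ρ', rfl⟩, hne⟩ := hext ρ (hs hρ)
      rcases ρ' with _ | ⟨_ | _, ρ'⟩
      · exact absurd (List.append_nil σ) hne
      · exact Or.inl (hτ.subset ⟨hs hρ, ρ', by simp⟩)
      · exact Or.inr ⟨ρ', by simp⟩
    by_cases hmem : τ ∈ s
    · have : s = Insert.insert τ right := by
        ext ρ
        have := eq_or_right ρ
        grind
      rw [this]
      exact insert σ τ right (hτ.superset rfl).2 (fun ρ hρ => (Finset.mem_filter.1 hρ).2)
        right_holds
    · have : s = right := (Finset.filter_true_of_mem fun ρ hρ =>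
        (eq_or_right ρ hρ).resolve_left (ne_of_mem_of_not_mem hρ hmem)).symm
      rwa [this]

theorem IsCombTree.exists_morleyList_comb (h : IsCombTree L A Up Uq n t)
    (hnode : ∀ σ, σ.length < n → Realizes L Uq A (t σ)) {X : Set (List Bool)} (hX : IsRightComb X)
    {s : Finset (List Bool)} (hs : ↑s ⊆ X) (hlen : ∀ σ ∈ s, σ.length < n) :
    ∃ S : List (List Bool), (∀ σ, σ ∈ S ↔ σ ∈ s) ∧ MorleyList L Uq A (S.map t) := by
  revert hlen
  refine hX.finset_induction (p := fun s => (∀ σ ∈ s, σ.length < n) → ∃ S : List (List Bool),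
    (∀ σ, σ ∈ S ↔ σ ∈ s) ∧ MorleyList L Uq A (S.map t)) ?_ ?_ ?_ s hs
  · exact fun _ => ⟨[], by simp, trivial⟩
  · refine fun σ hσ => ⟨[σ], by simp, morleyList_singleton.2 (hnode σ ?_)⟩
    exact hσ σ (Finset.mem_singleton_self σ)
  · intro σ τ s hτ hs ih hlen
    obtain ⟨S, hS, hmorley⟩ := ih fun ρ hρ => hlen ρ (Finset.mem_insert_of_mem hρ)
    refine ⟨τ :: S, fun ρ => by simp [hS], hmorley,
      (h.realizes_comb σ τ hτ (hlen τ (Finset.mem_insert_self τ s))).mono_entries ?_⟩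
    exact List.forall_mem_map.2 fun ρ hρ => Set.mem_image_of_mem t
      ⟨hs ρ ((hS ρ).1 hρ), hlen ρ (Finset.mem_insert_of_mem ((hS ρ).1 hρ))⟩

/-- The nodes of height less than `n` of the binary tree, every node after those above it. -/
def binaryNodes : ℕ → List (List Bool)
  | 0 => []
  | n + 1 => (binaryNodes n).map (true :: ·) ++ (binaryNodes n).map (false :: ·) ++ [ [] ]

theorem mem_binaryNodes {σ : List Bool} : σ ∈ binaryNodes n ↔ σ.length < n := by
  induction n generalizing σ with
  | zero => simp [binaryNodes]
  | succ n ih => rcases σ with _ | ⟨_ | _, σ⟩ <;> simp [binaryNodes, ih]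

theorem IsSubstitutable.exists_append_map_smul [Nonempty M] [Finite ι] {κ : Cardinal.{w}}
    (hM : IsMonster L M κ) (hA : #A < κ) {c : ι → M} {l₁ l₂ : List (ι → M)}
    (h₁ : IsSubstitutable L A c l₁) (h₂ : IsSubstitutable L A c l₂) {β : Type*} [Finite β]
    {U : Ultrafilter (β → M)} {e : β → M} (hU : U ∈ invariantExtensions L A e)
    (he : entries {v | v ∈ l₂} ⊆ Set.range e) :
    ∃ g : autFixing L A, Realizes L U (A ∪ entries {v | v ∈ l₁}) (g • e) ∧
      IsSubstitutable L A c (l₁ ++ l₂.map (g • ·)) := by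
  obtain ⟨g, hg⟩ := hM.exists_realizes_smul hA hU.2 (finite_entries (List.finite_toSet l₁))
  refine ⟨g, hg, h₁.append hM hA (h₂.map_smul g) hU.1 ?_ hg⟩
  rw [entries_map_smul, range_smul]
  exact Set.smul_set_mono he

theorem exists_isCombTree [Nonempty M] [Finite ι] {κ : Cardinal.{w}} (hM : IsMonster L M κ)
    (hA : #A < κ) {Rp Rq : Ultrafilter (M → M)} (hRp : Rp ∈ invariantExtensions L A id)
    (hRq : Rq ∈ invariantExtensions L A id) {c : ι → M} (huniv : IsUniversal L A c Rq) (n : ℕ) :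
    ∃ t, IsCombTree L A (reindex Rp c) (reindex Rq c) n t ∧
      IsSubstitutable L A c ((binaryNodes n).map t) := by
  induction n with
  | zero => exact ⟨fun _ => c, isCombTree_zero, trivial⟩
  | succ n ih =>
    obtain ⟨right, hright, hsubst⟩ := ih
    set l := (binaryNodes n).map right with hl
    have mem_l {σ : List Bool} (hσ : σ.length < n) : right σ ∈ l :=
      List.mem_map_of_mem (mem_binaryNodes.2 hσ)
    obtain ⟨R', hR', hR'q⟩ := huniv l hsubst
    have := (finite_entries (List.finite_toSet l)).to_subtype
    have hR'l : reindex R' (↑) ∈ invariantExtensions L A ((↑) : entries {v | v ∈ l} → M) :=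
      reindex_mem_invariantExtensions hR' _
    have hRpc : reindex Rp c ∈ invariantExtensions L A c := reindex_mem_invariantExtensions hRp c
    have hRqc : reindex Rq c ∈ invariantExtensions L A c := reindex_mem_invariantExtensions hRq c
    obtain ⟨g, hg, hsubst_left⟩ := hsubst.exists_append_map_smul hM hA hsubst hR'l
      Subtype.range_coe.ge
    obtain ⟨h, hh, hsubst_root⟩ := hsubst_left.exists_append_map_smul hM hA
      isSubstitutable_singleton hRpc (by simp [entries])
    refine ⟨fun σ => match σ with
      | [] => h • c
      | true :: σ => right σ
      | false :: σ => g • right σ, isCombTree_succ ?_ ?_ fun σ hσ => ?_, ?_⟩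
    · exact Bool.rec (hright.smul hRpc.1 hRqc.1 g) hright
    · refine hh.mono_entries ?_
      rintro _ ⟨_ | ⟨_ | _, σ⟩, ⟨hne, hlen⟩, rfl⟩
      · exact absurd rfl hne
      · exact List.mem_append_right _
          (List.mem_map_of_mem (mem_l (Nat.succ_lt_succ_iff.1 hlen)))
      · exact List.mem_append_left _ (mem_l (Nat.succ_lt_succ_iff.1 hlen))
    · rw [← hR'q _ (mem_l hσ)]
      refine (realizes_smul_of_realizes_entries hg (mem_l hσ)).mono_entries ?_
      exact Set.image_subset_iff.2 fun τ hτ => mem_l hτ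
    · simpa [binaryNodes, Function.comp_def, hl] using hsubst_root

end Trees

section Compactness

/-- The formula in the variables `(z j)` expressing that the formulas `ψ(x, z j)`, for `j` in `s`,
are jointly satisfiable. -/
noncomputable def jointSatisfiabilityFormula {β ι J : Type*} [Finite β] (ψ : L.Formula (β ⊕ ι))
    (s : Finset J) : L.Formula (J × ι) :=
  Formula.iExs β (Formula.iInf fun j : s =>
    ψ.relabel (Sum.elim Sum.inr fun i => Sum.inl ((j : J), i)))

theorem realize_jointSatisfiabilityFormula {N : Type*} [L.Structure N] {β ι J : Type*} [Finite β]
    {ψ : L.Formula (β ⊕ ι)} {s : Finset J} {y : J × ι → N} :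
    (jointSatisfiabilityFormula ψ s).Realize y ↔
      JointlySatisfiable ψ ((fun j i => y (j, i)) '' s) := by
  simp only [jointSatisfiabilityFormula, JointlySatisfiable, Set.forall_mem_image,
    Formula.realize_iExs, Formula.realize_iInf, Formula.realize_relabel, Subtype.forall,
    Sum.comp_elim, Sum.elim_comp_inr]
  rfl

variable {T : L.Theory} {M : Type w} [L.Structure M] [Nonempty M] [M ⊨ T]

theorem exists_modelType_of_ultrafilter {α : Type} (U : Ultrafilter (α → M)) :
    ∃ (N : Theory.ModelType.{u, v, max u v} T) (x : α → N),
      ∀ φ : L.Formula α, φ.Realize x ↔ {v : α → M | φ.Realize v} ∈ U := by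
  obtain ⟨p, hp⟩ := exists_completeType_of_ultrafilter (T := T) U
  obtain ⟨N, x, rfl⟩ := Theory.exists_modelType_is_realized_in T p
  exact ⟨N, x, fun φ => Theory.CompleteType.formula_mem_typeOf.symm.trans (hp φ)⟩

theorem exists_modelType_jointlySatisfiable_iff {D J ι : Type} (V : Ultrafilter D)
    (t : D → J → ι → M) :
    ∃ (N : Theory.ModelType.{u, v, max u v} T) (b : J → ι → N),
      ∀ {β : Type} [Finite β] (ψ : L.Formula (β ⊕ ι)) (s : Finset J),
        JointlySatisfiable ψ (b '' s) ↔ ∀ᶠ d in V, JointlySatisfiable ψ (t d '' s) := by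
  obtain ⟨N, x, hx⟩ := exists_modelType_of_ultrafilter (T := T)
    (V.map fun d (p : J × ι) => t d p.1 p.2)
  refine ⟨N, fun j i => x (j, i), fun ψ s => ?_⟩
  rw [← realize_jointSatisfiabilityFormula, hx, Ultrafilter.mem_map]
  exact Filter.eventually_congr (Filter.Eventually.of_forall fun d =>
    realize_jointSatisfiabilityFormula)

theorem hasKCTP_of_finite_trees {k l m : ℕ} (ψ : L.Formula (Fin l ⊕ Fin m))
    (t : ℕ → List Bool → Fin m → M)
    (hpath : ∀ n (α : ℕ → Bool) (s : Finset ℕ), s.card = k → (∀ i ∈ s, i < n) →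
      ¬JointlySatisfiable ψ ((fun i => t n ((List.range i).map α)) '' s))
    (hcomb : ∀ n X, IsRightComb X → ∀ s : Finset (List Bool), ↑s ⊆ X → (∀ σ ∈ s, σ.length < n) →
      JointlySatisfiable ψ (t n '' s)) : HasKCTP k T := by
  classical
  obtain ⟨N, b, hb⟩ := exists_modelType_jointlySatisfiable_iff (T := T) (Filter.hyperfilter ℕ) t
  have eventually_length_lt (s : Finset (List Bool)) :
      ∀ᶠ n in Filter.hyperfilter ℕ, ∀ σ ∈ s, σ.length < n :=
    Filter.Eventually.filter_mono Nat.hyperfilter_le_atTop <|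
      (Filter.eventually_all_finset s).2 fun σ _ => Filter.eventually_gt_atTop _
  refine ⟨N, l, m, ψ, b, fun α s hs hconsistent => ?_, fun X hX => ?_⟩
  · let path : ℕ → List Bool := fun i => (List.range i).map α
    have hsat : JointlySatisfiable ψ (b '' (s.image path)) := by
      rw [Finset.coe_image, Set.image_image]
      exact isConsistent_iff_jointlySatisfiable.1 hconsistent s subset_rfl
    rw [hb] at hsat
    obtain ⟨n, hn, hlen⟩ := (hsat.and (eventually_length_lt (s.image path))).exists
    rw [Finset.coe_image, Set.image_image] at hn
    refine hpath n α s hs (fun i hi => ?_) hn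
    simpa [path] using hlen _ (Finset.mem_image_of_mem path hi)
  · refine isConsistent_iff_jointlySatisfiable.2 fun s hs => (hb ψ s).2 ?_
    exact (eventually_length_lt s).mono fun n => hcomb n X hX s hs

end Compactness

section Universality

variable {T : L.Theory} {M : Type w} [L.Structure M] [Nonempty M] [M ⊨ T] {κ : Cardinal.{w}}
  {A : Set M}

theorem MorleyInconsistent.of_isUniversal (hT : ¬HasCTP T) (hM : IsMonster L M κ) (hA : #A < κ)
    {Rp Rq : Ultrafilter (M → M)} (hRp : Rp ∈ invariantExtensions L A id)
    (hRq : Rq ∈ invariantExtensions L A id) {l m : ℕ} {c : Fin m → M}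
    (huniv : IsUniversal L A c Rq) {ψ : L.Formula (Fin l ⊕ Fin m)}
    (hψ : MorleyInconsistent (reindex Rp c) A ψ) : MorleyInconsistent (reindex Rq c) A ψ := by
  obtain ⟨k, hk⟩ := hψ
  by_contra hconsistent
  have hRqc : reindex Rq c ∈ invariantExtensions L A c := reindex_mem_invariantExtensions hRq c
  choose t ht hsubst using exists_isCombTree hM hA hRp hRq huniv
  refine hT ⟨k, hasKCTP_of_finite_trees ψ t ?_ ?_⟩
  · intro n α s hs hlen hsat
    refine hk _ ?_ ((ht n).morleyList_path α hlen) ?_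
    · simpa using hs
    · simpa [Set.image] using hsat
  · intro n X hX s hs hlen
    have hnode (σ : List Bool) (hσ : σ.length < n) : Realizes L (reindex Rq c) A (t n σ) := by
      obtain ⟨g, hg⟩ := (hsubst n).mem_orbit (List.mem_map_of_mem (mem_binaryNodes.2 hσ))
      have hRqg : reindex Rq c ∈ invariantExtensions L A (g • c) := by
        rwa [invariantExtensions_smul]
      exact hg ▸ hRqg.2
    obtain ⟨S, hS, hmorley⟩ := (ht n).exists_morleyList_comb hnode hX hs hlen
    have := hmorley.jointlySatisfiable hM hA hRqc.1 hconsistent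
    simpa [hS, Set.image] using this

end Universality

section ForkingAndDividing

variable {M : Type w} [L.Structure M] [Nonempty M] {κ : Cardinal.{w}} {A : Set M} {α : Type}
  {m : ℕ} {φ : L.Formula (α ⊕ Fin m)} {b : Fin m → M}

theorem kimDivides_iff (hM : IsMonster L M κ) (hA : #A < κ) :
    KimDivides A φ b ↔
      ∃ R ∈ invariantExtensions L A id, MorleyInconsistent (reindex R b) A φ := by
  constructor
  · rintro ⟨p, hp, hpb, e, he, hφ⟩
    obtain ⟨R, hR, hRp⟩ := hp.exists_represents_reindex hpb
    exact ⟨R, hR, ((hRp.isMorleySequence_iff.1 he).morleyInconsistent_iff hM hA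
      (hR.1.reindex b)).2 hφ⟩
  · rintro ⟨R, hR, hφ⟩
    obtain ⟨p, hp⟩ := exists_represents_of_ultrafilter (L := L) (reindex R b)
    obtain ⟨e, he⟩ := exists_isUltrafilterMorleySequence hM (reindex R b) hA
    exact ⟨p, hM.isExtendiblyInvariant_of_represents hA hR hp,
      (hp.extends_tp_iff b).2 (reindex_mem_invariantExtensions hR b).2, e,
      hp.isMorleySequence_iff.2 he,
      (he.morleyInconsistent_iff hM hA (hR.1.reindex b)).1 hφ⟩

theorem KimDivides.kimForks (h : KimDivides A φ b) : KimForks A φ b :=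
  ⟨1, fun _ => m, fun _ => φ, fun _ => b, fun _ ha => ⟨0, ha⟩, fun _ => h⟩

theorem KimForks.exists_morleyInconsistent (h : KimForks A φ b) (hM : IsMonster L M κ)
    (hA : #A < κ) :
    ∃ (n N : ℕ) (c : Fin N → M) (j : Fin m → Fin N) (ψ : Fin n → L.Formula (α ⊕ Fin N)),
      c ∘ j = b ∧
      (∀ a : α → M, (φ.relabel (Sum.map id j)).Realize (Sum.elim a c) →
        ∃ i, (ψ i).Realize (Sum.elim a c)) ∧
      ∀ i, ∃ R ∈ invariantExtensions L A id, MorleyInconsistent (reindex R c) A (ψ i) := by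
  obtain ⟨n, m', ψ, c', himp, hdiv⟩ := h
  obtain ⟨N, ⟨e⟩⟩ := Finite.exists_equiv_fin (Fin m ⊕ Σ i, Fin (m' i))
  let c : Fin N → M := Sum.elim b (fun p => c' p.1 p.2) ∘ e.symm
  let j (i : Fin n) (r : Fin (m' i)) : Fin N := e (Sum.inr ⟨i, r⟩)
  have hcb : c ∘ e ∘ Sum.inl = b := funext fun r => by simp [c]
  have hcj (i : Fin n) : c ∘ j i = c' i := funext fun r => by simp [c, j]
  refine ⟨n, N, c, e ∘ Sum.inl, fun i => (ψ i).relabel (Sum.map id (j i)), hcb, ?_, fun i => ?_⟩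
  · simpa only [Formula.realize_relabel, Sum.elim_comp_map, Function.comp_id, hcb, hcj] using himp
  · obtain ⟨R, hR, hψ⟩ := (kimDivides_iff hM hA).1 (hdiv i)
    refine ⟨R, hR, ?_⟩
    rwa [morleyInconsistent_relabel_iff hM hA (hR.1.reindex c), reindex_reindex, hcj]

theorem KimForks.kimDivides {T : L.Theory} [M ⊨ T] (hT : ¬HasCTP T) (hM : IsMonster L M κ)
    (hA : #A < κ) (hbase : IsInvarianceBase L A) {l : ℕ} {φ : L.Formula (Fin l ⊕ Fin m)}
    (h : KimForks A φ b) : KimDivides A φ b := by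
  obtain ⟨n, N, c, j, ψ, rfl, himp, hψ⟩ := h.exists_morleyInconsistent hM hA
  obtain ⟨R, hR, huniv⟩ := exists_isUniversal hbase.invariantExtensions_nonempty c
  have hRc : reindex R c ∈ invariantExtensions L A c := reindex_mem_invariantExtensions hR c
  have inconsistent_ψ (i : Fin n) : MorleyInconsistent (reindex R c) A (ψ i) := by
    obtain ⟨Rp, hRp, hψi⟩ := hψ i
    exact hψi.of_isUniversal hT hM hA hRp hR huniv
  have inconsistent_φ : MorleyInconsistent (reindex R c) A (φ.relabel (Sum.map id j)) := by
    refine .of_imp_exists inconsistent_ψ fun v hv a ha => ?_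
    obtain ⟨g, rfl⟩ := hM.exists_smul_eq hA hRc.2 hv
    have realize_iff (θ : L.Formula (Fin l ⊕ Fin N)) :
        θ.Realize (Sum.elim a (g • c)) ↔ θ.Realize (Sum.elim (g⁻¹ • a) c) := by
      rw [← realize_smul g θ (Sum.elim (g⁻¹ • a) c), smul_sumElim, smul_inv_smul]
    simp only [realize_iff] at ha ⊢
    exact himp _ ha
  refine (kimDivides_iff hM hA).2 ⟨R, hR, ?_⟩
  rwa [morleyInconsistent_relabel_iff hM hA hRc.1, reindex_reindex] at inconsistent_φ

end ForkingAndDividing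

end KimForking

theorem mainTheorem5 {L : FirstOrder.Language.{u, v}} (T : L.Theory)
    (hT : ¬ KimForking.HasCTP T)
    (M : Type w) [L.Structure M] [Nonempty M] [M ⊨ T] (κ : Cardinal.{w})
    (hM : KimForking.IsMonster L M κ)
    (A : Set M) (hA : Cardinal.mk A < κ) (hbase : KimForking.IsInvarianceBase L A)
    (k m : ℕ) (φ : L.Formula (Fin k ⊕ Fin m)) (b : Fin m → M) :
    KimForking.KimForks A φ b ↔ KimForking.KimDivides A φ b :=
  ⟨fun h => h.kimDivides hT hM hA hbase, fun h => h.kimForks⟩
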